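/- Let $\Bbbk$ be a field. A $\Bbbk$-linear abelian category is called *finite over $\Bbbk$* if every object has a finite filtration with simple subquotients, every object has a projective cover, there are finitely many simple objects up to isomorphism, and all $\mathrm{Hom}$-spaces are finite-dimensional over $\Bbbk$. (It is well known that this holds if and only if the category is $\Bbbk$-linearly equivalent to the category of finite-dimensional modules over some finite-dimensional $\Bbbk$-algebra.) A *recollement* of abelian categories consists of functors $i_*:\mathcal A_Z\to\mathcal A$ and $j^*:\mathcal A\to\mathcal A_U$ together with adjoint triples $(i^*,i_*,i^!)$ and $(j_!,j^*,j_*)$, such that $i_*,j_!,j_*$ are fully faithful, $j^*i_*=0$, and every $X\in\mathcal A$ with $j^*X=0$ lies in the essential image of $i_*$. A *stratification* of a $\Bbbk$-linear abelian category $\mathcal A$ by a poset $\Lambda$ consists of $\Bbbk$-linear abelian categories $\mathcal A_{\Lambda'}$ for all lower subsets $\Lambda'\subseteq\Lambda$, fully faithful $\Bbbk$-linear functors $\mathcal A_{\Lambda''}\hookrightarrow\mathcal A_{\Lambda'}$ for lower subsets $\Lambda''\subseteq\Lambda'$, and $\Bbbk$-linear abelian categories $\mathcal A_\lambda$ for $\lambda\in\Lambda$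 (the *strata categories*), such that: 1. $\mathcal A_\emptyset=0$ and $\mathcal A_\Lambda=\mathcal A$ (up to $\Bbbk$-linear equivalence); 2. for every lower subset $\Lambda'$ and every maximal element $\lambda$ of $\Lambda'$, the functor $i_*:\mathcal A_{\Lambda'\setminus\{\lambda\}}\hookrightarrow\mathcal A_{\Lambda'}$ is part of a recollement with $\Bbbk$-linear $j^*:\mathcal A_{\Lambda'}\to\mathcal A_\lambda$; 3. if $\lambda$ is a maximal element of both of the lower subsets $\Lambda''\subseteq\Lambda'$, then the composite $\mathcal A_{\Lambda''}\hookrightarrow\mathcal A_{\Lambda'}\to\mathcal A_\lambda$ is isomorphic to $j^*:\mathcal A_{\Lambda''}\to\mathcal A_\lambda$. **Corollary.** Let $\mathcal A$ be a $\Bbbk$-linear abelian category with a stratification by a finite poset $\Lambda$. Then $\mathcal A$ is finite over $\Bbbk$ if and only if every strata category $\mathcal A_\lambda$ $(\lambda\in\Lambda)$ is finite over $\Bbbk$. Likewise, $\mathcal A$ is $\Bbbk$-linearly equivalent to the category of finite-dimensional modules over some finite-dimensional $\Bbbk$-algebra if and only if the same is true of every $\mathcal A_\lambda$. -/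

import Mathlib

open CategoryTheory CategoryTheory.Limits

universe w v v₁ v₂ v₃ u u₁ u₂ u₃

namespace AbelianStratification

section Recollement

variable {Z : Type u₁} [Category.{v₁} Z] [Abelian Z]
  {A : Type u₂} [Category.{v₂} A] [Abelian A]
  {U : Type u₃} [Category.{v₃} U] [Abelian U]

/-- The data and conditions that make `i_* : Z ⥤ A` and `j^* : A ⥤ U` the two middle functors of a
recollement of abelian categories:
adjoint triples `(i^*, i_*, i^!)` and `(j_!, j^*, j_*)` in which `i_*`, `j_!`, `j_*` are fully
faithful, such that `j^* i_* = 0` and such that every object killed by `j^*` lies in the essential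
image of `i_*`. -/
structure Recollement (i : Z ⥤ A) (j : A ⥤ U) where
  /-- `i^*` -/
  iPull : A ⥤ Z
  /-- `i^!` -/
  iShriek : A ⥤ Z
  /-- `j_!` -/
  jShriek : U ⥤ A
  /-- `j_*` -/
  jPush : U ⥤ A
  iPullAdj : iPull ⊣ i
  iShriekAdj : i ⊣ iShriek
  jShriekAdj : jShriek ⊣ j
  jPushAdj : j ⊣ jPush
  i_full : i.Full
  i_faithful : i.Faithful
  jShriek_full : jShriek.Full
  jShriek_faithful : jShriek.Faithful
  jPush_full : jPush.Full
  jPush_faithful : jPush.Faithful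
  isZero_j_i : ∀ X : Z, IsZero (j.obj (i.obj X))
  essImage_of_isZero : ∀ X : A, IsZero (j.obj X) → i.essImage X

end Recollement

/-- A stratification of the `k`-linear abelian category `A` by the poset `Λ`, all categories and
functors being `k`-linear. Lower subsets of `Λ` are the elements of `LowerSet Λ`, and for `l`
maximal in `S` the lower set `S.erase l` is `S \ {l}`.
The functors `j_!`, `j_*`, `i^*`, `i^!` are automatically `k`-linear, being adjoint to
`k`-linear functors. -/
structure Stratification (k : Type w) [Field k] (A : Type u) [Category.{v} A] [Abelian A]
    [Linear k A] (Λ : Type u₁) [PartialOrder Λ] where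
  /-- the category attached to a lower subset -/
  cat : LowerSet Λ → Type u₂
  [catCategory : ∀ S, Category.{v₂} (cat S)]
  [catAbelian : ∀ S, Abelian (cat S)]
  [catLinear : ∀ S, Linear k (cat S)]
  /-- the embedding attached to an inclusion of lower subsets -/
  incl : ∀ {S T : LowerSet Λ}, S ≤ T → (cat S ⥤ cat T)
  incl_full : ∀ {S T : LowerSet Λ} (h : S ≤ T), (incl h).Full
  incl_faithful : ∀ {S T : LowerSet Λ} (h : S ≤ T), (incl h).Faithful
  incl_linear : ∀ {S T : LowerSet Λ} (h : S ≤ T), (incl h).Linear k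
  /-- the strata categories -/
  stratum : Λ → Type u₃
  [stratumCategory : ∀ l, Category.{v₃} (stratum l)]
  [stratumAbelian : ∀ l, Abelian (stratum l)]
  [stratumLinear : ∀ l, Linear k (stratum l)]
  /-- the category attached to the empty lower subset is zero -/
  isZero_bot : ∀ X : cat ⊥, IsZero X
  /-- the category attached to `Λ` itself is `A` -/
  total : cat ⊤ ≌ A
  total_linear : total.functor.Linear k
  /-- the functor `j^*` attached to a maximal element of a lower subset -/
  quot : ∀ {S : LowerSet Λ} {l : Λ}, Maximal (· ∈ S) l → (cat S ⥤ stratum l)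
  quot_linear : ∀ {S : LowerSet Λ} {l : Λ} (h : Maximal (· ∈ S) l), (quot h).Linear k
  /-- the recollement attached to a maximal element of a lower subset -/
  recollement : ∀ {S : LowerSet Λ} {l : Λ} (h : Maximal (· ∈ S) l),
    Recollement (incl (S := S.erase l) (T := S) LowerSet.erase_le) (quot h)
  /-- the functors to a fixed stratum are compatible with the embeddings -/
  incl_quot : ∀ {S T : LowerSet Λ} {l : Λ} (hST : S ≤ T) (hS : Maximal (· ∈ S) l)
    (hT : Maximal (· ∈ T) l), Nonempty (incl hST ⋙ quot hT ≅ quot hS)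

attribute [instance] Stratification.catCategory Stratification.catAbelian
  Stratification.catLinear Stratification.stratumCategory Stratification.stratumAbelian
  Stratification.stratumLinear

section Finite

variable {C : Type u} [Category.{v} C]

/-- An essential surjection: an epimorphism `φ` such that `α` is an epimorphism whenever `α ≫ φ`
is one. -/
def IsEssentialEpi {X Y : C} (φ : X ⟶ Y) : Prop :=
  Epi φ ∧ ∀ (X' : C) (α : X' ⟶ X), Epi (α ≫ φ) → Epi α

/-- A projective cover: an essential surjection from a projective object. -/
def IsProjectiveCover {P X : C} (φ : P ⟶ X) : Prop :=
  Projective P ∧ IsEssentialEpi φ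

/-- The object has a finite filtration with simple subquotients. -/
inductive HasFiniteLength [Abelian C] : C → Prop
  | zero (X : C) (hX : IsZero X) : HasFiniteLength X
  | extension (S : ShortComplex C) (hS : S.ShortExact) (h₁ : HasFiniteLength S.X₁)
      (h₃ : Simple S.X₃) : HasFiniteLength S.X₂

/-- A `k`-linear abelian category is finite over `k` if it is a length category in which every
object has a projective cover, with finitely many simple objects up to isomorphism and
finite-dimensional `Hom`-spaces. -/
structure IsFiniteOver (k : Type w) [Field k] (C : Type u) [Category.{v} C] [Abelian C]
    [Linear k C] : Prop where
  length : ∀ X : C, HasFiniteLength X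
  enough_projectives : ∀ X : C, ∃ (P : C) (φ : P ⟶ X), IsProjectiveCover φ
  finite_simples : ∃ (n : ℕ) (L : Fin n → C),
    (∀ a, Simple (L a)) ∧ ∀ X : C, Simple X → ∃ a, Nonempty (X ≅ L a)
  finite_hom : ∀ X Y : C, FiniteDimensional k (X ⟶ Y)

end Finite

section Modules

open scoped ModuleCat

variable (k : Type w) [Field k]

/-- The left modules over a `k`-algebra `R` that are finite-dimensional over `k`, as a full
subcategory of all left `R`-modules. -/
abbrev FDModuleCat (R : Type w) [Ring R] [Algebra k R] :=
  ObjectProperty.FullSubcategory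
    (fun M : ModuleCat.{w} R => FiniteDimensional k M)

/-- The `k`-linear abelian category `C` is equivalent, `k`-linearly, to the category of
finite-dimensional modules over some finite-dimensional `k`-algebra. -/
def IsModuleCategoryOver (C : Type u) [Category.{v} C] [Abelian C] [Linear k C] : Prop :=
  ∃ (R : Type w) (_ : Ring R) (_ : Algebra k R), FiniteDimensional k R ∧
    ∃ e : C ≌ FDModuleCat k R, e.functor.Linear k

end Modules

end AbelianStratification

/-! Peeling off maximal elements one at a time reduces the claim to a single recollement of `A` by
`Z` and `U`: `A` is finite over `k` exactly when `Z` and `U` are (`Recollement.isFiniteOver_left`,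
`Recollement.isFiniteOver_right`, `Recollement.isFiniteOver`).

Two tools carry this. First, finiteness is equivalent to finite-dimensional `Hom`-spaces together
with one projective object that detects nonzero objects (`isFiniteOver_iff_hasProgenerator`). This
form passes from `A` to `Z` along `i^*`. Second, in a length category `X` has a projective cover as
soon as its essential covers have bounded length (`exists_projectiveCover_of_bound`), since a
longest one is projective. No projective has to be constructed when passing to `U` or from `Z` and
`U` to `A`.

For the passage to `A`, an object `M` is built from `j_! j^* M` and a cokernel coming from `Z`. For
simple `L`, the image of `j_! L ⟶ j_* L` is simple with the kernel in `Z`, so lengths are finite. If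
`M` is an essential cover of `X`, then `dim Hom(M, Y)` is bounded independently of `M`. Taking `Y =
i_* K` and `Y = j_* L` with `K`, `L` simple bounds the two pieces, hence `M`.

The module-category version follows from Morita theory: a progenerator `G` gives an equivalence
`Hom(G, -)` with the finite-dimensional modules over the opposite of `End G`. -/

namespace AbelianStratification

/-! ### Objects of finite length -/

section Length

variable {C : Type u} [Category.{v} C] [Abelian C]

/-- The object has a filtration of length at most `n` with simple subquotients. -/
inductive LengthLE : ℕ → C → Prop
  | zero (n : ℕ) (X : C) (hX : IsZero X) : LengthLE n X
  | extension (n : ℕ) (S : ShortComplex C) (hS : S.ShortExact) (h₁ : LengthLE n S.X₁)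
      (h₃ : Simple S.X₃) : LengthLE (n + 1) S.X₂

theorem LengthLE.mono {n m : ℕ} {X : C} (h : LengthLE n X) (hnm : n ≤ m) : LengthLE m X := by
  induction h generalizing m with
  | zero n X hX => exact .zero _ _ hX
  | extension n S hS h₁ h₃ ih =>
    obtain ⟨m, rfl⟩ : ∃ m', m = m' + 1 := ⟨m - 1, by omega⟩
    exact .extension m S hS (ih (by omega)) h₃

theorem LengthLE.of_kernel {n : ℕ} {X T : C} [Simple T] (f : X ⟶ T) [Epi f]
    (h : LengthLE n (kernel f)) : LengthLE (n + 1) X :=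
  .extension n (ShortComplex.kernelSequence f)
    (ShortComplex.ShortExact.mk' (ShortComplex.kernelSequence_exact f) inferInstance ‹Epi f›) h
    ‹Simple T›

theorem exists_comp_eq_of_kernel_comp_eq_zero {X Y T : C} (f : X ⟶ Y) [hf : Epi f] (k : X ⟶ T)
    (h : kernel.ι f ≫ k = 0) : ∃ z, f ≫ z = k :=
  have : Epi (ShortComplex.kernelSequence f).g := hf
  ⟨(ShortComplex.kernelSequence_exact f).desc k h,
    (ShortComplex.kernelSequence_exact f).g_desc k h⟩

/-- The strict drop for non-monomorphisms replaces the Jordan–Hölder theorem. The cokernel of `X₁ ⟶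
Y` is a quotient of the simple `X₃`: if it is zero, one step is saved; if it is `X₃`, a failure of
injectivity already occurs on `X₁`. -/
theorem LengthLE.of_epi_aux {n : ℕ} {X : C} (h : LengthLE n X) :
    ∀ {Y : C} (f : X ⟶ Y) [Epi f],
      LengthLE n Y ∧ (¬ Mono f → ∃ m < n, LengthLE m Y) := by
  induction h with
  | zero n X hX =>
    intro Y f _
    exact ⟨.zero _ _ (hX.of_epi f), fun hf => (hf ⟨fun _ _ _ => hX.eq_of_tgt _ _⟩).elim⟩
  | extension n S hS h₁ h₃ ih =>
    intro Y f _
    have := hS.epi_g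
    have := hS.mono_f
    let π := cokernel.π (S.f ≫ f)
    obtain ⟨q, hq⟩ : ∃ q : S.X₃ ⟶ cokernel (S.f ≫ f), S.g ≫ q = f ≫ π :=
      ⟨hS.exact.desc (f ≫ π) (by
        rw [← Category.assoc]; exact cokernel.condition (S.f ≫ f)), hS.exact.g_desc _ _⟩
    by_cases h0 : q = 0
    · have : Epi (S.f ≫ f) := by
        apply Preadditive.epi_of_cokernel_zero
        rw [← cancel_epi f]
        change f ≫ π = _
        rw [← hq, h0, comp_zero, comp_zero]
      have hY := (ih (S.f ≫ f)).1
      exact ⟨hY.mono (Nat.le_succ n), fun _ => ⟨n, Nat.lt_succ_self n, hY⟩⟩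
    · have : Epi q := by
        have : Epi (S.g ≫ q) := by rw [hq]; infer_instance
        exact epi_of_epi S.g q
      have : IsIso q := isIso_of_epi_of_nonzero h0
      have hQ : Simple (cokernel (S.f ≫ f)) := Simple.of_iso (asIso q).symm
      obtain ⟨hI, hI'⟩ := ih (Abelian.factorThruImage (S.f ≫ f))
      refine ⟨.of_kernel (cokernel.π (S.f ≫ f)) hI, fun hf => ?_⟩
      have hmono : ¬ Mono (Abelian.factorThruImage (S.f ≫ f)) := by
        refine fun hmono => hf ?_
        apply Preadditive.mono_of_cancel_zero
        intro T x hx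
        have hxg : x ≫ S.g = 0 := by
          rw [← cancel_mono q, Category.assoc, hq, ← Category.assoc, hx, zero_comp, zero_comp]
        obtain ⟨y, rfl⟩ : ∃ y, y ≫ S.f = x := ⟨hS.exact.lift x hxg, hS.exact.lift_f _ _⟩
        have : Mono (S.f ≫ f) := by
          rw [← Abelian.image.fac (S.f ≫ f)]; exact mono_comp _ _
        have : y = 0 := by
          rw [← cancel_mono (S.f ≫ f), ← Category.assoc, hx, zero_comp]
        rw [this, zero_comp]
      obtain ⟨m, hm, hI⟩ := hI' hmono
      exact ⟨m + 1, by omega, .of_kernel (cokernel.π (S.f ≫ f)) hI⟩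

theorem LengthLE.of_mono_aux {n : ℕ} {X : C} (h : LengthLE n X) :
    ∀ {Y : C} (f : Y ⟶ X) [Mono f],
      LengthLE n Y ∧ (¬ Epi f → ∃ m < n, LengthLE m Y) := by
  induction h with
  | zero n X hX =>
    intro Y f _
    exact ⟨.zero _ _ (hX.of_mono f), fun hf => (hf ⟨fun _ _ _ => hX.eq_of_src _ _⟩).elim⟩
  | extension n S hS h₁ h₃ ih =>
    intro Y f _
    have := hS.epi_g
    have := hS.mono_f
    by_cases h0 : f ≫ S.g = 0
    · obtain ⟨y, hy⟩ : ∃ y, y ≫ S.f = f := ⟨hS.exact.lift f h0, hS.exact.lift_f _ _⟩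
      have : Mono (y ≫ S.f) := by rw [hy]; infer_instance
      have := mono_of_mono y S.f
      have hY := (ih y).1
      exact ⟨hY.mono (Nat.le_succ n), fun _ => ⟨n, Nat.lt_succ_self n, hY⟩⟩
    · have hepi : Epi (f ≫ S.g) := epi_of_nonzero_to_simple h0
      obtain ⟨y, hy⟩ : ∃ y, y ≫ S.f = kernel.ι (f ≫ S.g) ≫ f :=
        ⟨hS.exact.lift (kernel.ι (f ≫ S.g) ≫ f)
          (by simp), hS.exact.lift_f _ _⟩
      have : Mono (y ≫ S.f) := by rw [hy]; infer_instance
      have := mono_of_mono y S.f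
      obtain ⟨hI, hI'⟩ := ih y
      refine ⟨.of_kernel (f ≫ S.g) hI, fun hf => ?_⟩
      have hepi' : ¬ Epi y := by
        refine fun hy' => hf ?_
        apply Preadditive.epi_of_cancel_zero
        intro T x hx
        have hfx : S.f ≫ x = 0 := by
          rw [← cancel_epi y, ← Category.assoc, hy, Category.assoc, hx, comp_zero, comp_zero]
        obtain ⟨z, rfl⟩ : ∃ z, S.g ≫ z = x := ⟨hS.exact.desc x hfx, hS.exact.g_desc _ _⟩
        have : z = 0 := by
          rw [← cancel_epi (f ≫ S.g), Category.assoc, hx, comp_zero]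
        rw [this, comp_zero]
      obtain ⟨m, hm, hI⟩ := hI' hepi'
      exact ⟨m + 1, by omega, .of_kernel (f ≫ S.g) hI⟩

theorem LengthLE.of_epi {n : ℕ} {X Y : C} (h : LengthLE n X) (f : X ⟶ Y) [Epi f] :
    LengthLE n Y :=
  (h.of_epi_aux f).1

theorem LengthLE.of_mono {n : ℕ} {X Y : C} (h : LengthLE n X) (f : Y ⟶ X) [Mono f] :
    LengthLE n Y :=
  (h.of_mono_aux f).1

/-- Exactness in the middle suffices. Climbing the filtration of `X₃`, each simple subquotient
either receives zero from `X₂` or splits one simple quotient off it. -/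
theorem LengthLE.of_exact {a b : ℕ} {X₃ : C} (h₃ : LengthLE b X₃) {X₁ X₂ : C}
    (h₁ : LengthLE a X₁) (f : X₁ ⟶ X₂) (g : X₂ ⟶ X₃) (w : f ≫ g = 0)
    (hex : (ShortComplex.mk f g w).Exact) : LengthLE (a + b) X₂ := by
  induction h₃ generalizing X₁ X₂ with
  | zero n X hX =>
    have : Epi f := (ShortComplex.exact_iff_epi _ (hX.eq_of_tgt g 0)).mp hex
    exact (h₁.of_epi f).mono (Nat.le_add_right a n)
  | extension n S hS h₃ hs ih =>
    have := hS.mono_f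
    rw [ShortComplex.exact_iff_exact_up_to_refinements] at hex
    by_cases h0 : g ≫ S.g = 0
    · obtain ⟨g', rfl⟩ : ∃ g', g' ≫ S.f = g := ⟨hS.exact.lift g h0, hS.exact.lift_f _ _⟩
      refine (ih h₁ f g' (by rw [← cancel_mono S.f]; simpa using w) ?_).mono (by omega)
      rw [ShortComplex.exact_iff_exact_up_to_refinements]
      intro T x hx
      exact hex x (by dsimp at hx ⊢; rw [reassoc_of% hx, zero_comp])
    · have hepi : Epi (g ≫ S.g) := epi_of_nonzero_to_simple h0
      obtain ⟨g', hg'⟩ : ∃ y, y ≫ S.f = kernel.ι (g ≫ S.g) ≫ g :=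
        ⟨hS.exact.lift (kernel.ι (g ≫ S.g) ≫ g)
          (by simp), hS.exact.lift_f _ _⟩
      let f' : X₁ ⟶ kernel (g ≫ S.g) := kernel.lift _ f (by rw [reassoc_of% w, zero_comp])
      have hf' : f' ≫ kernel.ι _ = f := kernel.lift_ι _ _ _
      refine .of_kernel (g ≫ S.g) (n := a + n) (ih h₁ f' g' ?_ ?_)
      · rw [← cancel_mono S.f, Category.assoc, hg', reassoc_of% hf', w, zero_comp]
      · rw [ShortComplex.exact_iff_exact_up_to_refinements]
        intro T x hx
        obtain ⟨A, π, hπ, y, hy⟩ := hex (x ≫ kernel.ι _) (by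
          dsimp at hx ⊢; rw [Category.assoc, ← hg', reassoc_of% hx, zero_comp])
        refine ⟨A, π, hπ, y, ?_⟩
        dsimp at hy ⊢
        rw [← cancel_mono (kernel.ι _), Category.assoc, Category.assoc, hy, hf']

theorem LengthLE.of_simple (X : C) [Simple X] : LengthLE 1 X := by
  exact .of_kernel (𝟙 X) (.zero 0 _ (isZero_kernel_of_mono (𝟙 X)))

theorem hasFiniteLength_iff (X : C) : HasFiniteLength X ↔ ∃ n, LengthLE n X := by
  constructor
  · intro h
    induction h with
    | zero X hX => exact ⟨0, .zero _ _ hX⟩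
    | extension S hS h₁ h₃ ih =>
      obtain ⟨n, hn⟩ := ih
      exact ⟨n + 1, .extension n S hS hn h₃⟩
  · rintro ⟨n, h⟩
    induction h with
    | zero n X hX => exact .zero _ hX
    | extension n S hS h₁ h₃ ih => exact .extension S hS ih h₃

theorem HasFiniteLength.of_epi {X Y : C} (h : HasFiniteLength X) (f : X ⟶ Y) [Epi f] :
    HasFiniteLength Y := by
  rw [hasFiniteLength_iff] at h ⊢
  exact h.imp fun n hn => hn.of_epi f

theorem HasFiniteLength.of_mono {X Y : C} (h : HasFiniteLength X) (f : Y ⟶ X) [Mono f] :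
    HasFiniteLength Y := by
  rw [hasFiniteLength_iff] at h ⊢
  exact h.imp fun n hn => hn.of_mono f

theorem HasFiniteLength.of_exact {X₁ X₂ X₃ : C} (h₁ : HasFiniteLength X₁)
    (h₃ : HasFiniteLength X₃) (f : X₁ ⟶ X₂) (g : X₂ ⟶ X₃) (w : f ≫ g = 0)
    (hex : (ShortComplex.mk f g w).Exact) : HasFiniteLength X₂ := by
  rw [hasFiniteLength_iff] at h₁ h₃ ⊢
  obtain ⟨a, ha⟩ := h₁
  obtain ⟨b, hb⟩ := h₃
  exact ⟨a + b, hb.of_exact ha f g w hex⟩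

theorem HasFiniteLength.of_simple (X : C) [Simple X] : HasFiniteLength X :=
  (hasFiniteLength_iff X).mpr ⟨1, .of_simple X⟩

theorem HasFiniteLength.exists_simple_quotient {X : C} (h : HasFiniteLength X) (hX : ¬ IsZero X) :
    ∃ (S : C) (f : X ⟶ S), Simple S ∧ Epi f := by
  cases h with
  | zero X h => exact (hX h).elim
  | extension S hS h₁ h₃ => exact ⟨S.X₃, S.g, h₃, hS.epi_g⟩

/-- The simple quotients of an object of finite length fall into finitely many isomorphism
classes. -/
theorem HasFiniteLength.exists_simple_quotients {X : C} (h : HasFiniteLength X) :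
    ∃ (n : ℕ) (L : Fin n → C), ∀ (S : C) (f : X ⟶ S), Simple S → f ≠ 0 →
      ∃ a, Nonempty (S ≅ L a) := by
  induction h with
  | zero X hX => exact ⟨0, Fin.elim0, fun S f _ hf => (hf (hX.eq_of_src _ _)).elim⟩
  | extension S hS h₁ h₃ ih =>
    obtain ⟨n, L, hL⟩ := ih
    refine ⟨n + 1, Fin.cons S.X₃ L, fun T f hT hf => ?_⟩
    by_cases h0 : S.f ≫ f = 0
    · have := hS.epi_g
      obtain ⟨q, rfl⟩ : ∃ q, S.g ≫ q = f := ⟨hS.exact.desc f h0, hS.exact.g_desc _ _⟩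
      have : IsIso q := isIso_of_hom_simple (by rintro rfl; simp at hf)
      exact ⟨0, ⟨(asIso q).symm⟩⟩
    · obtain ⟨a, ha⟩ := hL T (S.f ≫ f) hT h0
      exact ⟨a.succ, ha⟩

end Length

/-! ### Essential epimorphisms and projective covers -/

section Essential

variable {C : Type u} [Category.{v} C]

theorem IsEssentialEpi.comp {X Y Z : C} {f : X ⟶ Y} {g : Y ⟶ Z} (hf : IsEssentialEpi f)
    (hg : IsEssentialEpi g) : IsEssentialEpi (f ≫ g) := by
  have := hf.1
  have := hg.1
  refine ⟨inferInstance, fun T α h => hf.2 T α (hg.2 T (α ≫ f) ?_)⟩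
  rwa [Category.assoc]

variable [Abelian C]

/-- Every epimorphism from an object of finite length becomes essential on a suitable subobject. -/
theorem HasFiniteLength.exists_essentialEpi {X Y : C} (h : HasFiniteLength X) (f : X ⟶ Y) [Epi f] :
    ∃ (T : C) (ι : T ⟶ X), Mono ι ∧ IsEssentialEpi (ι ≫ f) := by
  obtain ⟨n, hn⟩ := (hasFiniteLength_iff X).mp h
  clear h
  induction n using Nat.strong_induction_on generalizing X with
  | _ n ih =>
    by_cases hf : IsEssentialEpi f
    · exact ⟨X, 𝟙 X, inferInstance, by simpa using hf⟩
    · obtain ⟨T, α, h₁, h₂⟩ : ∃ (T : C) (α : T ⟶ X), Epi (α ≫ f) ∧ ¬ Epi α := by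
        simpa [IsEssentialEpi, show Epi f from inferInstance] using hf
      -- The image of a witness against essentiality is a proper subobject still mapping onto `Y`;
      -- its length bound drops, so the descent stops.
      have hι : ¬ Epi (Abelian.image.ι α) := fun h' => h₂ <| by
        rw [← Abelian.image.fac α]; exact epi_comp _ _
      obtain ⟨m, hm, hI⟩ := (hn.of_mono_aux (Abelian.image.ι α)).2 hι
      have : Epi (Abelian.image.ι α ≫ f) := by
        have : Epi (Abelian.factorThruImage α ≫ Abelian.image.ι α ≫ f) := by
          rwa [← Category.assoc, Abelian.image.fac α]
        exact epi_of_epi (Abelian.factorThruImage α) _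
      obtain ⟨T, ι, h₁, h₂⟩ := ih m hm (Abelian.image.ι α ≫ f) hI
      exact ⟨T, ι ≫ Abelian.image.ι α, mono_comp _ _, by simpa using h₂⟩

/-- In a length category, an object has a projective cover as soon as the lengths of its essential
covers are bounded. -/
theorem exists_projectiveCover_of_bound (hC : ∀ X : C, HasFiniteLength X) (X : C) (n : ℕ)
    (hn : ∀ (M : C) (φ : M ⟶ X), IsEssentialEpi φ → LengthLE n M) :
    ∃ (P : C) (φ : P ⟶ X), IsProjectiveCover φ := by
  classical
  have hex : ∃ n, ∀ (M : C) (φ : M ⟶ X), IsEssentialEpi φ → LengthLE n M := ⟨n, hn⟩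
  clear hn n
  let n := Nat.find hex
  have hn : ∀ (M : C) (φ : M ⟶ X), IsEssentialEpi φ → LengthLE n M := Nat.find_spec hex
  -- Minimality of the uniform bound `n` gives a cover attaining it; for `n = 0` the identity of `X`
  -- serves.
  obtain ⟨M, φ, hφ, hM⟩ : ∃ (M : C) (φ : M ⟶ X), IsEssentialEpi φ ∧
      ∀ m < n, ¬ LengthLE m M := by
    by_cases h0 : n = 0
    · exact ⟨X, 𝟙 X, ⟨inferInstance, fun T α h => by simpa using h⟩, by omega⟩
    · have := Nat.find_min hex (show n - 1 < Nat.find hex by omega)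
      push Not at this
      obtain ⟨M, φ, h₁, h₂⟩ := this
      exact ⟨M, φ, h₁, fun m hm h => h₂ (h.mono (by omega))⟩
  -- To lift `f` through `e`, cut the pullback down to an essential cover `T` of `M`. It is also one
  -- of `X`, so a nonzero kernel of `T ⟶ M` would make `M` too short. Thus `T ≅ M`, which gives the
  -- lift.
  refine ⟨M, φ, ⟨fun {E B} f e _ => ?_⟩, hφ⟩
  obtain ⟨T, ι, _, hι⟩ := (hC (pullback f e)).exists_essentialEpi (pullback.fst f e)
  have := hι.1
  have : Mono (ι ≫ pullback.fst f e) := by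
    by_contra h
    obtain ⟨m, hm, h'⟩ := ((hn T _ (hι.comp hφ)).of_epi_aux (ι ≫ pullback.fst f e)).2 h
    exact hM m hm h'
  have : IsIso (ι ≫ pullback.fst f e) := isIso_of_mono_of_epi _
  refine ⟨inv (ι ≫ pullback.fst f e) ≫ ι ≫ pullback.snd f e, ?_⟩
  rw [Category.assoc, Category.assoc, ← pullback.condition, ← Category.assoc ι,
    IsIso.inv_hom_id_assoc]

/-- The lift of `f` through `φ` is an epimorphism because `φ` is essential, so `M` is a quotient of
`P`. -/
theorem LengthLE.of_isEssentialEpi {P X M : C} [Projective P] (f : P ⟶ X) [Epi f] {n : ℕ}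
    (hn : LengthLE n P) {φ : M ⟶ X} (hφ : IsEssentialEpi φ) : LengthLE n M := by
  have := hφ.1
  have := hφ.2 P (Projective.factorThru f φ) (by rw [Projective.factorThru_comp]; infer_instance)
  exact hn.of_epi (Projective.factorThru f φ)

theorem exists_projectiveCover_of_projective (hC : ∀ X : C, HasFiniteLength X) {P X : C}
    [Projective P] (f : P ⟶ X) [Epi f] : ∃ (P : C) (φ : P ⟶ X), IsProjectiveCover φ := by
  obtain ⟨n, hn⟩ := (hasFiniteLength_iff P).mp (hC P)
  exact exists_projectiveCover_of_bound hC X n fun M φ hφ => hn.of_isEssentialEpi f hφ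

/-- The kernel of `φ` lies in every maximal subobject: if it mapped onto `S`, then `ker f` would
still surject onto `X`, forcing `ker f = M`. -/
theorem IsEssentialEpi.exists_factor {M X S : C} {φ : M ⟶ X} (hφ : IsEssentialEpi φ)
    [Simple S] (f : M ⟶ S) : ∃ g : X ⟶ S, φ ≫ g = f := by
  have := hφ.1
  by_cases h : kernel.ι φ ≫ f = 0
  · exact exists_comp_eq_of_kernel_comp_eq_zero φ f h
  · have hι : Epi (kernel.ι f) := by
      apply hφ.2
      apply Preadditive.epi_of_cancel_zero
      intro T x hx
      have : Epi f := epi_of_nonzero_to_simple (by rintro rfl; simp at h)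
      obtain ⟨z, hz⟩ : ∃ z, f ≫ z = φ ≫ x :=
        exists_comp_eq_of_kernel_comp_eq_zero f (φ ≫ x) (by simpa using hx)
      have : Epi (kernel.ι φ ≫ f) := epi_of_nonzero_to_simple h
      have : z = 0 := by
        rw [← cancel_epi (kernel.ι φ ≫ f), Category.assoc, hz, kernel.condition_assoc, zero_comp,
          comp_zero]
      rw [← cancel_epi φ, ← hz, this, comp_zero, comp_zero]
    have : f = 0 := by rw [← cancel_epi (kernel.ι f), kernel.condition, comp_zero]
    exact (h (by rw [this, comp_zero])).elim

end Essential

/-! ### Length under right exact functors -/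

section Functors

variable {C : Type u₁} [Category.{v₁} C] [Abelian C] {D : Type u₂} [Category.{v₂} D] [Abelian D]

theorem LengthLE.map {F : C ⥤ D} [F.PreservesZeroMorphisms] [PreservesFiniteColimits F] {c : ℕ}
    (hF : ∀ L : C, Simple L → LengthLE c (F.obj L)) {n : ℕ} {X : C} (h : LengthLE n X) :
    LengthLE (n * c) (F.obj X) := by
  induction h with
  | zero n X hX => exact .zero _ _ (F.map_isZero hX)
  | extension n S hS h₁ h₃ ih =>
    have := hS.epi_g
    rw [Nat.succ_mul]
    exact (hF _ h₃).of_exact ih (F.map S.f) (F.map S.g) _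
      (hS.exact.map_of_epi_of_preservesCokernel F ‹_› inferInstance)

theorem HasFiniteLength.map {F : C ⥤ D} [F.PreservesZeroMorphisms] [PreservesFiniteColimits F]
    (hF : ∀ L : C, Simple L → HasFiniteLength (F.obj L)) {X : C} (h : HasFiniteLength X) :
    HasFiniteLength (F.obj X) := by
  induction h with
  | zero X hX => exact .zero _ (F.map_isZero hX)
  | extension S hS h₁ h₃ ih =>
    have := hS.epi_g
    exact ih.of_exact (hF _ h₃) (F.map S.f) (F.map S.g) _
      (hS.exact.map_of_epi_of_preservesCokernel F ‹_› inferInstance)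

end Functors

/-! ### Finiteness through a progenerator -/

/-- The `Hom`-spaces are finite-dimensional and there is a projective object mapping nontrivially
to every nonzero object. -/
def HasProgenerator (k : Type w) [Field k] (C : Type u) [Category.{v} C] [Preadditive C]
    [Linear k C] : Prop :=
  (∀ X Y : C, FiniteDimensional k (X ⟶ Y)) ∧
    ∃ G : C, Projective G ∧ ∀ X : C, (∀ f : G ⟶ X, f = 0) → IsZero X

section Transport

variable {k : Type w} [Field k] {C : Type u₁} [Category.{v₁} C] {D : Type u₂} [Category.{v₂} D]
  [Preadditive C] [Linear k C] [Preadditive D] [Linear k D]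

theorem HasProgenerator.of_equivalence (e : C ≌ D) [e.functor.Additive] [e.functor.Linear k]
    (h : HasProgenerator k D) : HasProgenerator k C := by
  obtain ⟨h₁, G, hG, h₂⟩ := h
  refine ⟨fun X Y => ?_, e.inverse.obj G, e.symm.map_projective_iff G |>.mpr hG, fun X hX => ?_⟩
  · have := h₁ (e.functor.obj X) (e.functor.obj Y)
    exact FiniteDimensional.of_injective (e.functor.mapLinearMap k)
      (e.functor.map_injective (X := X) (Y := Y))
  · have hZ : IsZero (e.functor.obj X) := by
      refine h₂ _ fun f => e.inverse.map_injective ?_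
      rw [Functor.map_zero, ← cancel_mono (e.unitIso.inv.app X), zero_comp]
      exact hX _
    exact (e.inverse.map_isZero hZ).of_iso (e.unitIso.app X)

end Transport

section Simples

variable {C : Type u} [Category.{v} C] [Abelian C]

theorem exists_simples_of_finite {ι : Type*} [Finite ι] (L : ι → C)
    (h : ∀ S : C, Simple S → ∃ a, Nonempty (S ≅ L a)) :
    ∃ (n : ℕ) (L : Fin n → C),
      (∀ a, Simple (L a)) ∧ ∀ X : C, Simple X → ∃ a, Nonempty (X ≅ L a) := by
  classical
  obtain ⟨n, ⟨e⟩⟩ := Finite.exists_equiv_fin {i // Simple (L i)}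
  refine ⟨n, fun a => L (e.symm a).1, fun a => (e.symm a).2, fun X hX => ?_⟩
  obtain ⟨a, ⟨i⟩⟩ := h X hX
  exact ⟨e ⟨a, Simple.of_iso i.symm⟩, ⟨i ≪≫ eqToIso (by simp)⟩⟩

theorem exists_simples_of_quotients {ι : Type*} [Finite ι] (L : ι → C)
    (hL : ∀ a, HasFiniteLength (L a))
    (h : ∀ S : C, Simple S → ∃ (a : ι) (f : L a ⟶ S), f ≠ 0) :
    ∃ (n : ℕ) (L : Fin n → C),
      (∀ a, Simple (L a)) ∧ ∀ X : C, Simple X → ∃ a, Nonempty (X ≅ L a) := by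
  choose n T hT using fun a => (hL a).exists_simple_quotients
  refine exists_simples_of_finite (ι := Σ a, Fin (n a)) (fun p => T p.1 p.2) fun S hS => ?_
  obtain ⟨a, f, hf⟩ := h S hS
  obtain ⟨b, hb⟩ := hT a S f hS hf
  exact ⟨⟨a, b⟩, hb⟩

end Simples

section Finite

attribute [local instance] Abelian.hasFiniteBiproducts

variable {k : Type w} [Field k] {C : Type u} [Category.{v} C] [Abelian C] [Linear k C]

instance projective_biproduct {ι : Type*} (P : ι → C) [HasBiproduct P] [∀ a, Projective (P a)] :
    Projective (⨁ P) where
  factors f e _ :=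
    ⟨biproduct.desc fun a => Projective.factorThru (biproduct.ι P a ≫ f) e, by
      ext a; simp [Projective.factorThru_comp]⟩

theorem finrank_hom_kernel_add {G X Y : C} [Projective G] [FiniteDimensional k (G ⟶ X)]
    (f : X ⟶ Y) [Epi f] :
    Module.finrank k (G ⟶ Y) + Module.finrank k (G ⟶ kernel f) = Module.finrank k (G ⟶ X) := by
  rw [← LinearMap.finrank_range_add_finrank_ker (Linear.rightComp k G f)]
  congr 1
  · rw [LinearMap.range_eq_top.mpr, finrank_top]
    exact fun g => ⟨Projective.factorThru g f, Projective.factorThru_comp g f⟩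
  · rw [← LinearMap.finrank_range_of_inj (f := Linear.rightComp k G (kernel.ι f))
      fun a b h => by simpa [cancel_mono] using h]
    have : LinearMap.range (Linear.rightComp k G (kernel.ι f)) =
        LinearMap.ker (Linear.rightComp k G f) := ?_
    · rw [this]
    ext g
    simp only [LinearMap.mem_range, LinearMap.mem_ker, Linear.rightComp_apply]
    exact ⟨fun ⟨y, hy⟩ => by rw [← hy, Category.assoc, kernel.condition, comp_zero],
      fun h => ⟨kernel.lift f g h, kernel.lift_ι _ _ _⟩⟩

/-- Take maps spanning `Hom(G, X)`. Every map from `G` to the cokernel lifts to `X`, is a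
combination of these maps and so vanishes. -/
theorem exists_epi_biproduct_of_progenerator {G : C} [Projective G]
    (hG : ∀ X : C, (∀ f : G ⟶ X, f = 0) → IsZero X) (X : C) [FiniteDimensional k (G ⟶ X)] :
    ∃ (n : ℕ) (f : Fin n → (G ⟶ X)), Epi (biproduct.desc f) := by
  obtain ⟨n, s, hs⟩ := Submodule.fg_iff_exists_fin_generating_family.mp
    (Module.Finite.fg_top (R := k) (M := G ⟶ X))
  refine ⟨n, s, ?_⟩
  have hz : IsZero (cokernel (biproduct.desc s)) := by
    refine hG _ fun g => ?_
    rw [← Projective.factorThru_comp g (cokernel.π (biproduct.desc s))]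
    have hle : Submodule.span k (Set.range s) ≤
        LinearMap.ker (Linear.rightComp k G (cokernel.π (biproduct.desc s))) := by
      rw [Submodule.span_le]
      rintro _ ⟨a, rfl⟩
      have := biproduct.ι _ a ≫= cokernel.condition (biproduct.desc s)
      rwa [biproduct.ι_desc_assoc, comp_zero] at this
    exact hle (hs ▸ Submodule.mem_top)
  exact Preadditive.epi_of_cokernel_zero (hz.eq_of_tgt _ _)

theorem hasFiniteLength_of_progenerator (hfin : ∀ X Y : C, FiniteDimensional k (X ⟶ Y)) {G : C}
    [Projective G] (hG : ∀ X : C, (∀ f : G ⟶ X, f = 0) → IsZero X) (X : C) :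
    HasFiniteLength X := by
  classical
  induction hn : Module.finrank k (G ⟶ X) using Nat.strong_induction_on generalizing X with
  | _ n ih =>
    by_cases hX : IsZero X
    · exact .zero X hX
    have hpos : ∀ Y : C, ¬ IsZero Y → 0 < Module.finrank k (G ⟶ Y) := fun Y hY => by
      by_contra h
      have := Module.finrank_zero_iff.mp (Nat.eq_zero_of_not_pos h)
      exact hY (hG Y fun f => Subsingleton.elim _ _)
    -- A nonzero quotient with `dim Hom(G, Q)` least is simple: a nonzero quotient of `Q` has the
    -- same dimension, so the kernel receives no nonzero map from `G`.
    have hex : ∃ m, ∃ (Q : C) (q : X ⟶ Q), Epi q ∧ ¬ IsZero Q ∧ Module.finrank k (G ⟶ Q) = m :=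
      ⟨_, X, 𝟙 X, inferInstance, hX, rfl⟩
    obtain ⟨Q, q, hq, hQ, hQm⟩ := Nat.find_spec hex
    have hs : Simple Q := by
      refine simple_of_cosimple Q fun {T} f _ => ⟨fun _ h0 => hQ ?_, fun h0 => ?_⟩
      · subst h0
        rw [IsZero.iff_id_eq_zero, ← IsIso.hom_inv_id (0 : Q ⟶ T), zero_comp]
      · have hT : ¬ IsZero T := fun hT => h0 (hT.eq_of_tgt _ _)
        have h₁ := Nat.find_min' hex ⟨T, q ≫ f, inferInstance, hT, rfl⟩
        have h₂ := finrank_hom_kernel_add (k := k) (G := G) f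
        have hk : IsZero (kernel f) := by
          by_contra h
          have := hpos _ h
          omega
        have := Preadditive.mono_of_kernel_zero (hk.eq_of_src (kernel.ι f) 0)
        exact isIso_of_mono_of_epi f
    have h₂ := finrank_hom_kernel_add (k := k) (G := G) q
    have h₃ := hpos _ hQ
    exact (ih _ (by omega) (kernel q) rfl).of_exact (.of_simple Q) (kernel.ι q) q _
      (ShortComplex.kernelSequence_exact q)

theorem HasProgenerator.isFiniteOver (h : HasProgenerator k C) : IsFiniteOver k C := by
  obtain ⟨hfin, G, _, hG⟩ := h
  have hl := hasFiniteLength_of_progenerator hfin hG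
  refine ⟨hl, fun X => ?_, ?_, hfin⟩
  · obtain ⟨n, f, _⟩ := exists_epi_biproduct_of_progenerator (k := k) hG X
    exact exists_projectiveCover_of_projective hl (biproduct.desc f)
  · refine exists_simples_of_quotients (ι := Unit) (fun _ => G) (fun _ => hl G) fun S hS => ⟨(), ?_⟩
    by_contra h
    push Not at h
    exact Simple.not_isZero S (hG S h)

/-- The sum of the projective covers of the simples works: a nonzero `X` has a simple quotient, and
the cover of that simple lifts to a nonzero map to `X`. -/
theorem IsFiniteOver.hasProgenerator (h : IsFiniteOver k C) : HasProgenerator k C := by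
  obtain ⟨hl, hp, ⟨n, L, hL, hS⟩, hfin⟩ := h
  choose P φ hφ using fun a => hp (L a)
  have := fun a => (hφ a).1
  refine ⟨hfin, ⨁ P, inferInstance, fun X hX => ?_⟩
  by_contra h0
  obtain ⟨S, f, hSs, _⟩ := (hl X).exists_simple_quotient h0
  obtain ⟨a, ⟨i⟩⟩ := hS S hSs
  have := (hφ a).2.1
  have h₁ := biproduct.ι P a ≫= hX (biproduct.π P a ≫ Projective.factorThru (φ a) (f ≫ i.hom))
  have h₂ : φ a = 0 := by
    rw [← Projective.factorThru_comp (φ a) (f ≫ i.hom)]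
    simp only [biproduct.ι_π_self_assoc, comp_zero] at h₁
    rw [h₁, zero_comp]
  have := hL a
  exact Simple.not_isZero (L a) (IsZero.of_epi_eq_zero _ h₂)

theorem isFiniteOver_iff_hasProgenerator : IsFiniteOver k C ↔ HasProgenerator k C :=
  ⟨fun h => h.hasProgenerator, fun h => h.isFiniteOver⟩

end Finite

section TransportFinite

variable {k : Type w} [Field k] {C : Type u₁} [Category.{v₁} C] {D : Type u₂} [Category.{v₂} D]

theorem additive_of_isEquivalence [Abelian C] [Preadditive D] (F : C ⥤ D) [F.IsEquivalence] :
    F.Additive :=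
  F.additive_of_preserves_binary_products

theorem IsFiniteOver.iff_of_equivalence [Abelian C] [Abelian D] [Linear k C] [Linear k D]
    (e : C ≌ D) [e.functor.Linear k] : IsFiniteOver k C ↔ IsFiniteOver k D := by
  have := additive_of_isEquivalence e.functor
  have : e.symm.functor.Additive := additive_of_isEquivalence e.inverse
  have : e.symm.functor.Linear k := e.inverseLinear k
  rw [isFiniteOver_iff_hasProgenerator, isFiniteOver_iff_hasProgenerator]
  exact ⟨.of_equivalence e.symm, .of_equivalence e⟩

end TransportFinite

/-! ### Uniform bounds for `Hom`-spaces and lengths -/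

section Bounds

variable {k : Type w} [Field k] {C : Type u} [Category.{v} C] [Abelian C] [Linear k C]

theorem finrank_le_of_surjective {V W : Type*} [AddCommGroup V] [Module k V] [AddCommGroup W]
    [Module k W] [FiniteDimensional k V] (f : V →ₗ[k] W) (hf : Function.Surjective f) :
    Module.finrank k W ≤ Module.finrank k V := by
  rw [← finrank_top k W, ← LinearMap.range_eq_top.mpr hf]
  exact LinearMap.finrank_range_le f

/-- The dimensions of the spaces of maps from essential covers of `X` to `Y` are bounded. -/
theorem exists_finrank_hom_le (hfin : ∀ X Y : C, FiniteDimensional k (X ⟶ Y)) (X : C) {Y : C}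
    (hY : HasFiniteLength Y) :
    ∃ c, ∀ (M : C) (φ : M ⟶ X), IsEssentialEpi φ → Module.finrank k (M ⟶ Y) ≤ c := by
  induction hY with
  | zero Y hY =>
    refine ⟨0, fun M φ _ => ?_⟩
    have : Subsingleton (M ⟶ Y) := ⟨fun _ _ => hY.eq_of_tgt _ _⟩
    exact (Module.finrank_zero_of_subsingleton).le
  | extension S hS h₁ h₃ ih =>
    obtain ⟨c, hc⟩ := ih
    have := hS.mono_f
    refine ⟨Module.finrank k (X ⟶ S.X₃) + c, fun M φ hφ => ?_⟩
    rw [← LinearMap.finrank_range_add_finrank_ker (Linear.rightComp k M S.g)]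
    refine Nat.add_le_add ?_ (le_trans ?_ (hc M φ hφ))
    -- Maps from an essential cover to a simple object all factor through `X`, so each simple layer
    -- contributes a constant independent of `M`.
    · exact (Submodule.finrank_le _).trans
        (finrank_le_of_surjective (Linear.leftComp k S.X₃ φ) fun f => hφ.exists_factor f)
    · have h : LinearMap.ker (Linear.rightComp k M S.g) ≤
          LinearMap.range (Linear.rightComp k M S.f) :=
        fun g hg => ⟨hS.exact.lift g hg, hS.exact.lift_f _ _⟩
      exact (Submodule.finrank_mono h).trans (LinearMap.finrank_range_le _)

/-- The length of an object is bounded in terms of the spaces of maps to the simple objects. -/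
theorem IsFiniteOver.exists_length_bound (h : IsFiniteOver k C) {n : ℕ} (L : Fin n → C)
    (hL : ∀ a, Simple (L a)) (hS : ∀ X : C, Simple X → ∃ a, Nonempty (X ≅ L a)) (c : Fin n → ℕ) :
    ∃ N, ∀ B : C, (∀ a, Module.finrank k (B ⟶ L a) ≤ c a) → LengthLE N B := by
  have hfin := h.finite_hom
  choose P φ hφ using fun a => h.enough_projectives (L a)
  have := fun a => (hφ a).1
  choose m hm using fun a => (hasFiniteLength_iff (P a)).mp (h.length (P a))
  let m₀ := Finset.univ.sup m
  -- Dividing `B` by the image of a projective cover lifted from a simple quotient costs at most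
  -- `m₀` in length and destroys the quotient map, so `d` drops.
  have key : ∀ (d : ℕ) (B : C), ∑ a, Module.finrank k (B ⟶ L a) ≤ d → LengthLE (d * m₀) B := by
    intro d
    induction d using Nat.strong_induction_on with
    | _ d ih =>
      intro B hB
      by_cases h0 : IsZero B
      · exact .zero _ _ h0
      obtain ⟨S, f, hSs, _⟩ := (h.length B).exists_simple_quotient h0
      obtain ⟨a, ⟨e⟩⟩ := hS S hSs
      let π := f ≫ e.hom
      let g := Projective.factorThru (φ a) π
      have hg : g ≫ π = φ a := Projective.factorThru_comp _ _
      have hinj : ∀ b, Function.Injective (Linear.leftComp k (L b) (cokernel.π g)) :=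
        fun b x y hxy => by simpa [cancel_epi] using hxy
      have hlt : ∑ b, Module.finrank k (cokernel g ⟶ L b) < ∑ b, Module.finrank k (B ⟶ L b) := by
        refine Finset.sum_lt_sum (fun b _ => LinearMap.finrank_le_finrank_of_injective (hinj b))
          ⟨a, Finset.mem_univ a, ?_⟩
        rw [← LinearMap.finrank_range_of_inj (hinj a)]
        refine Submodule.finrank_lt ((ne_of_mem_of_not_mem' (a := π) Submodule.mem_top ?_).symm)
        rintro ⟨z, hz⟩
        have h₁ : φ a = 0 := by
          rw [← hg, ← hz, Linear.leftComp_apply, cokernel.condition_assoc, zero_comp]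
        have := hL a
        have := (hφ a).2.1
        exact Simple.not_isZero (L a) (IsZero.of_epi_eq_zero _ h₁)
      have hd : d - 1 + 1 = d := by omega
      have hB' := (ih (d - 1) (by omega) (cokernel g) (by omega)).of_exact
        ((hm a).mono (Finset.le_sup (Finset.mem_univ a))) g (cokernel.π g) (cokernel.condition g)
        (ShortComplex.cokernelSequence_exact g)
      refine hB'.mono (le_of_eq ?_)
      conv_rhs => rw [← hd, Nat.succ_mul, Nat.add_comm]
  exact ⟨(∑ a, c a) * m₀, fun B hB => key _ B (Finset.sum_le_sum fun a _ => hB a)⟩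

end Bounds

/-! ### Transposes under an adjunction -/

section Adjunction

variable {C : Type u₁} [Category.{v₁} C] {D : Type u₂} [Category.{v₂} D] {F : C ⥤ D} {G : D ⥤ C}

theorem unit_comp_map_homEquiv_symm (adj : F ⊣ G) {X : C} {Y : D} (f : X ⟶ G.obj Y) :
    adj.unit.app X ≫ G.map ((adj.homEquiv X Y).symm f) = f :=
  (adj.homEquiv_unit X Y _).symm.trans (Equiv.apply_symm_apply _ f)

theorem map_homEquiv_comp_counit (adj : F ⊣ G) {X : C} {Y : D} (f : F.obj X ⟶ Y) :
    F.map (adj.homEquiv X Y f) ≫ adj.counit.app Y = f :=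
  (adj.homEquiv_counit X Y _).symm.trans (Equiv.symm_apply_apply _ f)

theorem homEquiv_symm_ne_zero [HasZeroMorphisms C] [HasZeroMorphisms D]
    [G.PreservesZeroMorphisms] (adj : F ⊣ G) {X : C} {Y : D} {f : X ⟶ G.obj Y} (hf : f ≠ 0) :
    (adj.homEquiv X Y).symm f ≠ 0 := fun h => hf <| by
  rw [← unit_comp_map_homEquiv_symm adj f, h, G.map_zero, comp_zero]

theorem homEquiv_ne_zero [HasZeroMorphisms C] [HasZeroMorphisms D]
    [F.PreservesZeroMorphisms] (adj : F ⊣ G) {X : C} {Y : D} {f : F.obj X ⟶ Y} (hf : f ≠ 0) :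
    adj.homEquiv X Y f ≠ 0 := fun h => hf <| by
  rw [← map_homEquiv_comp_counit adj f, h, F.map_zero, zero_comp]

end Adjunction

/-! ### Formal properties of a recollement -/

namespace Recollement

section

variable {Z : Type u₁} [Category.{v₁} Z] {A : Type u₂} [Category.{v₂} A]
  {U : Type u₃} [Category.{v₃} U] {i : Z ⥤ A} {j : A ⥤ U}

theorem preservesFiniteLimits_i [Abelian Z] [Abelian A] [Abelian U] (R : Recollement i j) :
    PreservesFiniteLimits i :=
  have := R.iPullAdj.isRightAdjoint
  inferInstance

theorem preservesFiniteColimits_i [Abelian Z] [Abelian A] [Abelian U] (R : Recollement i j) :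
    PreservesFiniteColimits i :=
  have := R.iShriekAdj.isLeftAdjoint
  inferInstance

theorem preservesFiniteLimits_j [Abelian Z] [Abelian A] [Abelian U] (R : Recollement i j) :
    PreservesFiniteLimits j :=
  have := R.jShriekAdj.isRightAdjoint
  inferInstance

theorem preservesFiniteColimits_j [Abelian Z] [Abelian A] [Abelian U] (R : Recollement i j) :
    PreservesFiniteColimits j :=
  have := R.jPushAdj.isLeftAdjoint
  inferInstance

theorem isIso_jShriek_unit [Abelian Z] [Abelian A] [Abelian U]
    (R : Recollement i j) (Y : U) : IsIso (R.jShriekAdj.unit.app Y) :=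
  have := R.jShriek_full
  have := R.jShriek_faithful
  inferInstance

theorem isIso_jPush_counit [Abelian Z] [Abelian A] [Abelian U]
    (R : Recollement i j) (Y : U) : IsIso (R.jPushAdj.counit.app Y) :=
  have := R.jPush_full
  have := R.jPush_faithful
  inferInstance

theorem hom_jShriek_eq_zero [Abelian Z] [Abelian A] [Abelian U]
    (R : Recollement i j) {X : A} (hX : IsZero (j.obj X)) {Y : U}
    (f : R.jShriek.obj Y ⟶ X) : f = 0 :=
  (R.jShriekAdj.homEquiv Y X).injective (hX.eq_of_tgt _ _)

theorem hom_jPush_eq_zero [Abelian Z] [Abelian A] [Abelian U]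
    (R : Recollement i j) {X : A} (hX : IsZero (j.obj X)) {Y : U}
    (f : X ⟶ R.jPush.obj Y) : f = 0 :=
  (R.jPushAdj.homEquiv X Y).symm.injective (hX.eq_of_src _ _)

end

variable {Z : Type u₁} [Category.{v₁} Z] [Abelian Z]
  {A : Type u₂} [Category.{v₂} A] [Abelian A]
  {U : Type u₃} [Category.{v₃} U] [Abelian U]
  {i : Z ⥤ A} {j : A ⥤ U}

theorem additive_i (R : Recollement i j) : i.Additive :=
  have := R.preservesFiniteLimits_i
  i.additive_of_preserves_binary_products

theorem additive_j (R : Recollement i j) : j.Additive :=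
  have := R.preservesFiniteLimits_j
  j.additive_of_preserves_binary_products

theorem isZero_j_kernel (R : Recollement i j) {X Y : A} (f : X ⟶ Y) [Mono (j.map f)] :
    IsZero (j.obj (kernel f)) := by
  have := R.preservesFiniteLimits_j
  have := R.additive_j
  refine IsZero.of_mono_eq_zero (j.map (kernel.ι f)) ?_
  rw [← cancel_mono (j.map f), ← j.map_comp, kernel.condition, j.map_zero, zero_comp]

theorem isZero_j_cokernel (R : Recollement i j) {X Y : A} (f : X ⟶ Y) [Epi (j.map f)] :
    IsZero (j.obj (cokernel f)) := by
  have := R.preservesFiniteColimits_j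
  have := R.additive_j
  refine IsZero.of_epi_eq_zero (j.map (cokernel.π f)) ?_
  rw [← cancel_epi (j.map f), ← j.map_comp, cokernel.condition, j.map_zero, comp_zero]

theorem isIso_map_jShriek_counit (R : Recollement i j) (X : A) :
    IsIso (j.map (R.jShriekAdj.counit.app X)) := by
  have := R.isIso_jShriek_unit (j.obj X)
  exact IsIso.of_isIso_fac_left (R.jShriekAdj.right_triangle_components X)

/-- A nonzero subobject `Y` of `j^* S` transposes to a nonzero, hence epic, map `j_! Y ⟶ S`;
applying `j^*` recovers the inclusion, which is therefore epic. -/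
theorem simple_j (R : Recollement i j) (S : A) [Simple S] (h : ¬ IsZero (j.obj S)) :
    Simple (j.obj S) := by
  have := R.preservesFiniteColimits_j
  have := R.additive_j
  refine ⟨fun {Y} m _ => ⟨fun _ h0 => h ?_, fun hm => ?_⟩⟩
  · subst h0
    rw [IsZero.iff_id_eq_zero, ← IsIso.inv_hom_id (0 : Y ⟶ j.obj S), comp_zero]
  · let g := (R.jShriekAdj.homEquiv Y S).symm m
    have hg : R.jShriekAdj.unit.app Y ≫ j.map g = m := unit_comp_map_homEquiv_symm R.jShriekAdj m
    have : Epi g := epi_of_nonzero_to_simple (homEquiv_symm_ne_zero R.jShriekAdj hm)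
    have := R.isIso_jShriek_unit Y
    have : Epi m := by rw [← hg]; infer_instance
    exact isIso_of_mono_of_epi m

theorem lengthLE_j (R : Recollement i j) {n : ℕ} {X : A} (h : LengthLE n X) :
    LengthLE n (j.obj X) := by
  have := R.preservesFiniteColimits_j
  have := R.additive_j
  have := h.map (F := j) (c := 1) fun S _ => by
    by_cases hS : IsZero (j.obj S)
    · exact .zero _ _ hS
    · have := R.simple_j S hS
      exact .of_simple _
  rwa [mul_one] at this

theorem simple_i (R : Recollement i j) (L : Z) [Simple L] : Simple (i.obj L) := by
  have := R.preservesFiniteLimits_j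
  have := R.additive_i
  have := R.i_full
  have := R.i_faithful
  refine ⟨fun {Y} m _ => ⟨fun _ h0 => Simple.not_isZero L ?_, fun hm => ?_⟩⟩
  · subst h0
    rw [IsZero.iff_id_eq_zero]
    apply i.map_injective
    rw [i.map_id, ← IsIso.inv_hom_id (0 : Y ⟶ i.obj L), comp_zero, i.map_zero]
  · obtain ⟨W, ⟨e⟩⟩ := R.essImage_of_isZero Y ((R.isZero_j_i L).of_mono (j.map m))
    obtain ⟨m', hm'⟩ := i.map_surjective (e.hom ≫ m)
    have : Mono (i.map m') := by rw [hm']; infer_instance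
    have := i.mono_of_mono_map this
    have : IsIso m' := isIso_of_mono_of_nonzero (by
      rintro rfl
      rw [i.map_zero] at hm'
      exact hm (by rw [← cancel_epi e.hom, ← hm', comp_zero]))
    rw [show m = e.inv ≫ i.map m' by rw [hm', e.inv_hom_id_assoc]]
    infer_instance

/-- `j_! X` has no nonzero quotient killed by `j^*`, so a map into it is epic once its image under
`j^*` is; essentiality can thus be tested in `U`. -/
theorem isEssentialEpi_jShriek (R : Recollement i j) {X Y : U} {φ : X ⟶ Y}
    (hφ : IsEssentialEpi φ) : IsEssentialEpi (R.jShriek.map φ) := by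
  have := R.jShriekAdj.isLeftAdjoint
  have := R.preservesFiniteColimits_j
  have := hφ.1
  have hX := R.isIso_jShriek_unit X
  have hY := R.isIso_jShriek_unit Y
  refine ⟨inferInstance, fun T α h => ?_⟩
  have h₁ : Epi (j.map α ≫ inv (R.jShriekAdj.unit.app X)) := by
    refine hφ.2 _ _ ?_
    have h₂ : inv (R.jShriekAdj.unit.app X) ≫ φ =
        j.map (R.jShriek.map φ) ≫ inv (R.jShriekAdj.unit.app Y) := by
      rw [IsIso.inv_comp_eq, ← Category.assoc, IsIso.eq_comp_inv]
      exact R.jShriekAdj.unit.naturality φ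
    rw [Category.assoc, h₂, ← Category.assoc, ← j.map_comp]
    infer_instance
  have : Epi (j.map α) := by
    have := epi_comp (j.map α ≫ inv (R.jShriekAdj.unit.app X)) (R.jShriekAdj.unit.app X)
    rwa [Category.assoc, IsIso.inv_hom_id, Category.comp_id] at this
  exact Preadditive.epi_of_cokernel_zero (R.hom_jShriek_eq_zero (R.isZero_j_cokernel α) _)

/-! ### Finiteness across a recollement -/

section Finite

variable {k : Type w} [Field k] [Linear k A]

/-- `i^*` sends a progenerator to one: its right adjoint `i_*` is exact and reflects zero objects.
-/
theorem isFiniteOver_left [Linear k Z] [i.Linear k] (R : Recollement i j)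
    (h : IsFiniteOver k A) : IsFiniteOver k Z := by
  have := R.preservesFiniteColimits_i
  have := R.additive_i
  have := R.i_full
  have := R.i_faithful
  rw [isFiniteOver_iff_hasProgenerator] at h ⊢
  obtain ⟨hfin, G, hG, h⟩ := h
  refine ⟨fun X Y => ?_, R.iPull.obj G, R.iPullAdj.map_projective G hG, fun X hX => ?_⟩
  · have := hfin (i.obj X) (i.obj Y)
    exact FiniteDimensional.of_injective (i.mapLinearMap k) (i.map_injective (X := X) (Y := Y))
  · have hi : IsZero (i.obj X) := h _ fun f =>
      (R.iPullAdj.homEquiv G X).symm.injective ((hX _).trans (hX _).symm)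
    rw [IsZero.iff_id_eq_zero] at hi ⊢
    apply i.map_injective
    rw [i.map_id, hi, i.map_zero]

theorem isFiniteOver_right [Linear k U] [j.Linear k] (R : Recollement i j)
    (h : IsFiniteOver k A) : IsFiniteOver k U := by
  have := R.additive_j
  have := fun Y => R.isIso_jShriek_unit Y
  have hlen : ∀ {n : ℕ} {Y : U}, LengthLE n (R.jShriek.obj Y) → LengthLE n Y := fun {n Y} h =>
    (R.lengthLE_j h).of_epi (inv (R.jShriekAdj.unit.app Y))
  have hlength : ∀ Y : U, HasFiniteLength Y := fun Y => by
    obtain ⟨n, hn⟩ := (hasFiniteLength_iff _).mp (h.length (R.jShriek.obj Y))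
    exact (hasFiniteLength_iff _).mpr ⟨n, hlen hn⟩
  refine ⟨hlength, fun Y => ?_, ?_, fun X Y => ?_⟩
  -- `j^*` need not preserve projectives. Instead `j_!` carries essential covers of `Y` to essential
  -- covers of `j_! Y`, whose lengths are bounded by that of `P`.
  · obtain ⟨P, φ, hP, hφ⟩ := h.enough_projectives (R.jShriek.obj Y)
    have := hφ.1
    obtain ⟨n, hn⟩ := (hasFiniteLength_iff P).mp (h.length P)
    exact exists_projectiveCover_of_bound hlength Y n fun M ψ hψ =>
      hlen (hn.of_isEssentialEpi φ (R.isEssentialEpi_jShriek hψ))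
  · obtain ⟨n, L, hL, hS⟩ := h.finite_simples
    refine exists_simples_of_finite (fun a => j.obj (L a)) fun T hT => ?_
    have h0 : ¬ IsZero (R.jShriek.obj T) := fun h0 =>
      Simple.not_isZero T ((j.map_isZero h0).of_iso (asIso (R.jShriekAdj.unit.app T)))
    obtain ⟨S, f, hSs, _⟩ := (h.length _).exists_simple_quotient h0
    obtain ⟨a, ⟨e⟩⟩ := hS S hSs
    have hj : ¬ IsZero (j.obj S) := fun hj => by
      have := R.hom_jShriek_eq_zero hj f
      exact Simple.not_isZero S (IsZero.of_epi_eq_zero f this)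
    have := R.simple_j S hj
    let g := R.jShriekAdj.homEquiv T S f
    have := R.jShriekAdj.left_adjoint_additive
    have hg : g ≠ 0 := homEquiv_ne_zero R.jShriekAdj fun h0 =>
      Simple.not_isZero S (IsZero.of_epi_eq_zero f h0)
    have : IsIso g := isIso_of_hom_simple hg
    exact ⟨a, ⟨asIso g ≪≫ j.mapIso e⟩⟩
  · have := h.finite_hom (R.jShriek.obj X) (R.jShriek.obj Y)
    refine Module.Finite.of_surjective (Linear.leftComp k Y (R.jShriekAdj.unit.app X) ∘ₗ
      Linear.rightComp k _ (inv (R.jShriekAdj.unit.app Y)) ∘ₗ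
      (j.mapLinearMap k : (R.jShriek.obj X ⟶ R.jShriek.obj Y) →ₗ[k] _)) fun g => ?_
    refine ⟨R.jShriek.map g, ?_⟩
    change R.jShriekAdj.unit.app X ≫ j.map (R.jShriek.map g) ≫ inv (R.jShriekAdj.unit.app Y) = g
    rw [← Category.assoc, IsIso.comp_inv_eq]
    exact (R.jShriekAdj.unit.naturality g).symm

theorem hasFiniteLength_of_isZero_j (R : Recollement i j) (hZ : ∀ X : Z, HasFiniteLength X)
    {X : A} (hX : IsZero (j.obj X)) : HasFiniteLength X := by
  have := R.preservesFiniteColimits_i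
  have := R.additive_i
  obtain ⟨W, ⟨e⟩⟩ := R.essImage_of_isZero X hX
  exact ((hZ W).map (F := i) fun L _ => have := R.simple_i L; .of_simple _).of_epi e.hom

/-- The image of the canonical map `j_! L ⟶ j_* L` is simple (the intermediate extension), and its
kernel is killed by `j^*`, hence comes from `Z`. -/
theorem hasFiniteLength_jShriek_of_simple (R : Recollement i j)
    (hZ : ∀ X : Z, HasFiniteLength X) (L : U) [Simple L] :
    HasFiniteLength (R.jShriek.obj L) := by
  have := R.preservesFiniteLimits_j
  have := R.preservesFiniteColimits_j
  have := R.additive_j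
  have := R.isIso_jShriek_unit L
  have := R.isIso_jPush_counit L
  let s : j.obj (R.jShriek.obj L) ⟶ L := inv (R.jShriekAdj.unit.app L)
  have : IsIso s := by dsimp only [s]; infer_instance
  let t := R.jPushAdj.homEquiv _ _ s
  have ht : j.map t ≫ R.jPushAdj.counit.app L = s :=
    map_homEquiv_comp_counit R.jPushAdj s
  have ht' : IsIso (j.map t) := by
    have : IsIso (j.map t ≫ R.jPushAdj.counit.app L) := by rw [ht]; infer_instance
    exact IsIso.of_isIso_comp_right _ (R.jPushAdj.counit.app L)
  let p := Abelian.factorThruImage t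
  let ι := Abelian.image.ι t
  have hpι : j.map p ≫ j.map ι = j.map t := by rw [← j.map_comp, Abelian.image.fac]
  have hι : Epi (j.map ι) := by
    have : Epi (j.map p ≫ j.map ι) := by rw [hpι]; infer_instance
    exact epi_of_epi (j.map p) _
  have hp : Mono (j.map p) := by
    have : Mono (j.map p ≫ j.map ι) := by rw [hpι]; infer_instance
    exact mono_of_mono _ (j.map ι)
  have : IsIso (j.map ι) := isIso_of_mono_of_epi _
  have hjI : Simple (j.obj (Abelian.image t)) :=
    Simple.of_iso (Y := L) (asIso (j.map ι) ≪≫ asIso (R.jPushAdj.counit.app L))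
  -- As a subobject of `j_* L` the image has no nonzero subobject killed by `j^*`; as a quotient of
  -- `j_! L`, no such quotient. Since `j^*` of it is simple, so is it.
  have hI : Simple (Abelian.image t) := by
    refine ⟨fun {Y} m _ => ⟨fun _ h0 => Simple.not_isZero (j.obj (Abelian.image t)) ?_,
      fun hm => ?_⟩⟩
    · subst h0
      refine j.map_isZero ?_
      rw [IsZero.iff_id_eq_zero, ← IsIso.inv_hom_id (0 : Y ⟶ Abelian.image t), comp_zero]
    · have hjm : j.map m ≠ 0 := fun h0 => by
        have hY : IsZero (j.obj Y) := IsZero.of_mono_eq_zero (j.map m) h0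
        have := R.hom_jPush_eq_zero hY (m ≫ ι)
        exact hm (by rw [← cancel_mono ι, this, zero_comp])
      have := isIso_of_mono_of_nonzero hjm
      have h0 := R.hom_jShriek_eq_zero (R.isZero_j_cokernel m) (p ≫ cokernel.π m)
      have : Epi m := Preadditive.epi_of_cokernel_zero (by rw [← cancel_epi p, h0, comp_zero])
      exact isIso_of_mono_of_epi m
  exact (R.hasFiniteLength_of_isZero_j hZ (R.isZero_j_kernel p)).of_exact (.of_simple _)
    (kernel.ι p) p _ (ShortComplex.kernelSequence_exact p)

theorem hasFiniteLength_jShriek (R : Recollement i j) (hZ : ∀ X : Z, HasFiniteLength X)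
    (hU : ∀ X : U, HasFiniteLength X) (Y : U) : HasFiniteLength (R.jShriek.obj Y) := by
  have := R.jShriekAdj.isLeftAdjoint
  exact (hU Y).map fun L _ => R.hasFiniteLength_jShriek_of_simple hZ L

theorem hasFiniteLength (R : Recollement i j) (hZ : ∀ X : Z, HasFiniteLength X)
    (hU : ∀ X : U, HasFiniteLength X) (X : A) : HasFiniteLength X := by
  have := R.isIso_map_jShriek_counit X
  exact (R.hasFiniteLength_jShriek hZ hU (j.obj X)).of_exact
    (R.hasFiniteLength_of_isZero_j hZ (R.isZero_j_cokernel (R.jShriekAdj.counit.app X)))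
    (R.jShriekAdj.counit.app X) (cokernel.π _) _ (ShortComplex.cokernelSequence_exact _)

/-- If `j^* f = 0`, the image of `f` comes from `Z`, so `f` factors as `X ⟶ i_* i^* X ⟶ i_* i^! Y ⟶
Y`. Hence the kernel of `Hom(X, Y) ⟶ Hom(j^* X, j^* Y)` lies in the image of `Hom(i^* X, i^! Y)`. -/
theorem finite_hom [Linear k Z] [Linear k U] [i.Linear k] [j.Linear k]
    (R : Recollement i j) (hZ : ∀ X Y : Z, FiniteDimensional k (X ⟶ Y))
    (hU : ∀ X Y : U, FiniteDimensional k (X ⟶ Y)) (X Y : A) : FiniteDimensional k (X ⟶ Y) := by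
  have := R.preservesFiniteLimits_j
  have := R.preservesFiniteColimits_j
  have := R.additive_j
  have := R.additive_i
  let F : (X ⟶ Y) →ₗ[k] (j.obj X ⟶ j.obj Y) := j.mapLinearMap k
  let Φ : (R.iPull.obj X ⟶ R.iShriek.obj Y) →ₗ[k] (X ⟶ Y) :=
    Linear.leftComp k Y (R.iPullAdj.unit.app X) ∘ₗ
      Linear.rightComp k _ (R.iShriekAdj.counit.app Y) ∘ₗ i.mapLinearMap k
  have hΦ : LinearMap.ker F ≤ LinearMap.range Φ := by
    intro f hf
    have hf : j.map f = 0 := hf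
    have h0 : IsZero (j.obj (Abelian.image f)) := by
      refine IsZero.of_epi_eq_zero (j.map (Abelian.factorThruImage f)) ?_
      rw [← cancel_mono (j.map (Abelian.image.ι f)), ← j.map_comp, Abelian.image.fac, hf, zero_comp]
    obtain ⟨W, ⟨e⟩⟩ := R.essImage_of_isZero _ h0
    let a := (R.iPullAdj.homEquiv X W).symm (Abelian.factorThruImage f ≫ e.inv)
    let b := R.iShriekAdj.homEquiv W Y (e.hom ≫ Abelian.image.ι f)
    have ha : R.iPullAdj.unit.app X ≫ i.map a = Abelian.factorThruImage f ≫ e.inv :=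
      unit_comp_map_homEquiv_symm R.iPullAdj _
    have hb : i.map b ≫ R.iShriekAdj.counit.app Y = e.hom ≫ Abelian.image.ι f :=
      map_homEquiv_comp_counit R.iShriekAdj _
    refine ⟨a ≫ b, ?_⟩
    change R.iPullAdj.unit.app X ≫ i.map (a ≫ b) ≫ R.iShriekAdj.counit.app Y = f
    rw [i.map_comp, Category.assoc, hb, reassoc_of% ha, e.inv_hom_id_assoc, Abelian.image.fac]
  have : FiniteDimensional k (LinearMap.ker F) := Submodule.finiteDimensional_of_le hΦ
  have : FiniteDimensional k ((X ⟶ Y) ⧸ LinearMap.ker F) :=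
    Module.Finite.equiv F.quotKerEquivRange.symm
  exact Module.Finite.of_submodule_quotient (LinearMap.ker F)

theorem exists_simple_quotients (R : Recollement i j) {m n : ℕ} {K : Fin m → Z} {L : Fin n → U}
    (hK : ∀ X : Z, Simple X → ∃ a, Nonempty (X ≅ K a))
    (hL : ∀ X : U, Simple X → ∃ a, Nonempty (X ≅ L a)) (S : A) [Simple S] :
    ∃ (a : Fin m ⊕ Fin n)
      (f : Sum.elim (fun a => i.obj (K a)) (fun a => R.jShriek.obj (L a)) a ⟶ S), f ≠ 0 := by
  have := R.i_full
  have := R.i_faithful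
  have := R.additive_i
  by_cases h : IsZero (j.obj S)
  · obtain ⟨W, ⟨e⟩⟩ := R.essImage_of_isZero S h
    have hW : Simple (i.obj W) := Simple.of_iso e
    have hW : Simple W := by
      have := R.preservesFiniteLimits_i
      refine ⟨fun {Y} m _ => ?_⟩
      rw [← isIso_iff_of_reflects_iso m i, Simple.mono_isIso_iff_nonzero, ne_eq, ne_eq,
        i.map_eq_zero_iff]
    obtain ⟨a, ⟨e'⟩⟩ := hK W hW
    refine ⟨.inl a, i.map e'.inv ≫ e.hom, fun h0 => Simple.not_isZero S ?_⟩
    exact IsZero.of_epi_eq_zero (i.map e'.inv ≫ e.hom) h0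
  · have := R.simple_j S h
    have := R.additive_j
    obtain ⟨a, ⟨e⟩⟩ := hL _ (R.simple_j S h)
    refine ⟨.inr a, (R.jShriekAdj.homEquiv _ _).symm e.inv, 
      homEquiv_symm_ne_zero R.jShriekAdj fun h0 => h ?_⟩
    exact IsZero.of_epi_eq_zero e.inv h0

theorem isFiniteOver [Linear k Z] [Linear k U] [i.Linear k] [j.Linear k]
    (R : Recollement i j) (hZ : IsFiniteOver k Z) (hU : IsFiniteOver k U) :
    IsFiniteOver k A := by
  have hlen := R.hasFiniteLength hZ.length hU.length
  have hfin := R.finite_hom hZ.finite_hom hU.finite_hom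
  obtain ⟨m, K, hK, hKS⟩ := hZ.finite_simples
  obtain ⟨n, L, hL, hLS⟩ := hU.finite_simples
  have := R.additive_i
  have := R.additive_j
  have := R.i_full
  have := R.i_faithful
  have := R.preservesFiniteColimits_i
  have := R.jShriekAdj.isLeftAdjoint
  refine ⟨hlen, fun X => ?_, exists_simples_of_quotients _ (fun _ => hlen _)
    fun S _ => R.exists_simple_quotients hKS hLS S, hfin⟩
  choose c hc using fun a => exists_finrank_hom_le hfin X (hlen (i.obj (K a)))
  choose d hd using fun a => exists_finrank_hom_le hfin X (hlen (R.jPush.obj (L a)))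
  obtain ⟨p, hp⟩ := hZ.exists_length_bound K hK hKS c
  obtain ⟨q, hq⟩ := hU.exists_length_bound L hL hLS d
  choose r hr using fun a => (hasFiniteLength_iff _).mp (hlen (R.jShriek.obj (L a)))
  -- `j_! j^* M` has at most `q` layers, each of length at most the largest `r`; the cokernel of the
  -- counit contributes `p`, since `i_*` preserves simples.
  refine exists_projectiveCover_of_bound hlen X
    (q * Finset.univ.sup r + p * 1) fun M φ hφ => ?_
  have hM : LengthLE q (j.obj M) := by
    refine hq _ fun a => le_trans ?_ (hd a M φ hφ)
    refine finrank_le_of_surjective (Linear.rightComp k _ (R.jPushAdj.counit.app (L a)) ∘ₗ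
      (j.mapLinearMap k : (M ⟶ R.jPush.obj (L a)) →ₗ[k] _)) fun g => ?_
    exact ⟨R.jPushAdj.homEquiv M (L a) g, map_homEquiv_comp_counit R.jPushAdj g⟩
  have := R.isIso_map_jShriek_counit M
  let π := cokernel.π (R.jShriekAdj.counit.app M)
  obtain ⟨W, ⟨e⟩⟩ := R.essImage_of_isZero _ (R.isZero_j_cokernel (R.jShriekAdj.counit.app M))
  -- `M` maps onto `i_* W`, so `Hom(W, K a)` embeds into `Hom(M, i_* (K a))`.
  have hW : LengthLE p W := by
    refine hp _ fun a => le_trans ?_ (hc a M φ hφ)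
    refine LinearMap.finrank_le_finrank_of_injective
      (f := Linear.leftComp k _ (π ≫ e.inv) ∘ₗ i.mapLinearMap k) fun x y hxy => ?_
    simp only [LinearMap.comp_apply, Functor.mapLinearMap_apply, Linear.leftComp_apply] at hxy
    exact i.map_injective ((cancel_epi (π ≫ e.inv)).mp hxy)
  have hQ : LengthLE (p * 1) (cokernel (R.jShriekAdj.counit.app M)) :=
    (hW.map (F := i) fun T _ => have := R.simple_i T; .of_simple _).of_epi e.hom
  refine hQ.of_exact (hM.map (F := R.jShriek) fun T hT => ?_) (R.jShriekAdj.counit.app M) π _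
    (ShortComplex.cokernelSequence_exact _)
  obtain ⟨a, ⟨e⟩⟩ := hLS T hT
  exact ((hr a).mono (Finset.le_sup (Finset.mem_univ a))).of_epi (R.jShriek.map e.inv)

end Finite

end Recollement

/-! ### Finite-dimensional modules have a progenerator -/

section FDModules

open scoped ModuleCat

variable {k : Type w} [Field k] {R : Type w} [Ring R] [Algebra k R]

theorem finiteDimensional_of_module_finite [FiniteDimensional k R] (M : ModuleCat.{w} R)
    [Module.Finite R M] : FiniteDimensional k M :=
  Module.Finite.trans R M

theorem surjective_of_epi_fdModuleCat [FiniteDimensional k R] {M N : FDModuleCat k R} (f : M ⟶ N)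
    [Epi f] : Function.Surjective f.hom.hom := by
  have := N.property
  have : Module.Finite R N.obj := Module.Finite.of_restrictScalars_finite k R N.obj
  let Q : FDModuleCat k R := ⟨ModuleCat.of R (N.obj ⧸ LinearMap.range f.hom.hom),
    finiteDimensional_of_module_finite _⟩
  let q : N ⟶ Q := ⟨ModuleCat.ofHom (LinearMap.range f.hom.hom).mkQ⟩
  have hq : q = 0 := by
    rw [← cancel_epi f, comp_zero]
    ext x
    exact (Submodule.Quotient.mk_eq_zero _).mpr ⟨x, rfl⟩
  intro y
  have : q.hom.hom y = 0 := by rw [hq]; rfl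
  exact (Submodule.Quotient.mk_eq_zero _).mp this

theorem hasProgenerator_fdModuleCat [FiniteDimensional k R] :
    HasProgenerator k (FDModuleCat k R) := by
  refine ⟨fun M N => ?_, ⟨ModuleCat.of R R, finiteDimensional_of_module_finite _⟩, ⟨?_⟩, ?_⟩
  · have := M.property
    have := N.property
    let F : (M ⟶ N) →ₗ[k] (M.obj →ₗ[k] N.obj) :=
      { toFun := fun f => f.hom.hom.restrictScalars k
        map_add' := fun _ _ => rfl
        map_smul' := fun _ _ => rfl }
    refine FiniteDimensional.of_injective F fun f g h => ?_
    ext x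
    exact LinearMap.congr_fun h x
  · intro E X f e _
    obtain ⟨x, hx⟩ := surjective_of_epi_fdModuleCat e (f.hom.hom (1 : R))
    refine ⟨⟨ModuleCat.ofHom (LinearMap.toSpanSingleton R E.obj x)⟩, ?_⟩
    ext
    change e.hom.hom ((1 : R) • x) = f.hom.hom (1 : R)
    rw [one_smul, hx]
  · intro M hM
    rw [IsZero.iff_id_eq_zero]
    ext x
    have := hM ⟨ModuleCat.ofHom (LinearMap.toSpanSingleton R M.obj x)⟩
    have h : (1 : R) • x = 0 :=
      congrArg (fun f : (⟨ModuleCat.of R R, finiteDimensional_of_module_finite _⟩ :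
        FDModuleCat k R) ⟶ M => f.hom.hom (1 : R)) this
    rw [one_smul] at h
    exact h

theorem IsModuleCategoryOver.isFiniteOver {C : Type u} [Category.{v} C] [Abelian C] [Linear k C]
    (h : IsModuleCategoryOver k C) : IsFiniteOver k C := by
  obtain ⟨R, _, _, _, e, _⟩ := h
  have := additive_of_isEquivalence e.functor
  exact (HasProgenerator.of_equivalence e hasProgenerator_fdModuleCat).isFiniteOver

end FDModules

/-! ### Morita theory: from a progenerator to modules -/

section Generator

attribute [local instance] Abelian.hasFiniteBiproducts

variable {C : Type u} [Category.{v} C] [Abelian C]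

theorem eq_zero_of_progenerator {G : C} [Projective G]
    (hG : ∀ X : C, (∀ f : G ⟶ X, f = 0) → IsZero X) {X Y : C} (f : X ⟶ Y)
    (hf : ∀ g : G ⟶ X, g ≫ f = 0) : f = 0 := by
  have h : IsZero (cokernel (kernel.ι f)) := hG _ fun g => by
    rw [← Projective.factorThru_comp g (cokernel.π (kernel.ι f)),
      ← kernel.lift_ι f _ (hf (Projective.factorThru g (cokernel.π (kernel.ι f)))),
      Category.assoc, cokernel.condition, comp_zero]
  have : Epi (kernel.ι f) := Preadditive.epi_of_cokernel_zero (h.eq_of_tgt _ _)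
  rw [← cancel_epi (kernel.ι f), kernel.condition, comp_zero]

theorem comp_biproduct_desc {n : ℕ} {T G X : C} (y : T ⟶ ⨁ fun _ : Fin n => G)
    (p : Fin n → (G ⟶ X)) :
    y ≫ biproduct.desc p = ∑ b, (y ≫ biproduct.π _ b) ≫ p b := by
  rw [biproduct.desc_eq, Preadditive.comp_sum]
  simp only [Category.assoc]

/-- A natural transformation between the functors represented on a progenerator comes from a
morphism. -/
theorem exists_eq_comp_of_equivariant {G : C} [Projective G]
    (hG : ∀ X : C, (∀ f : G ⟶ X, f = 0) → IsZero X) {X Y : C} {n : ℕ} (p : Fin n → (G ⟶ X))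
    [Epi (biproduct.desc p)] (ψ : (G ⟶ X) →+ (G ⟶ Y))
    (hψ : ∀ (e : G ⟶ G) (h : G ⟶ X), ψ (e ≫ h) = e ≫ ψ h) :
    ∃ f : X ⟶ Y, ∀ h, ψ h = h ≫ f := by
  let q := biproduct.desc fun b => ψ (p b)
  have hq : ∀ y, ψ (y ≫ biproduct.desc p) = y ≫ q := fun y => by
    rw [comp_biproduct_desc, comp_biproduct_desc, map_sum]
    exact Finset.sum_congr rfl fun b _ => hψ _ _
  -- `q` descends to `X` if it kills the kernel of the presentation. This can be tested on maps from
  -- `G`, where equivariance of `ψ` yields it.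
  obtain ⟨f, hf⟩ := exists_comp_eq_of_kernel_comp_eq_zero (biproduct.desc p) q
    (eq_zero_of_progenerator hG _ fun g => by
      rw [← Category.assoc, ← hq, Category.assoc, kernel.condition, comp_zero, map_zero])
  refine ⟨f, fun h => ?_⟩
  rw [← Projective.factorThru_comp h (biproduct.desc p), hq, Category.assoc, hf]

end Generator

section Morita

open scoped ModuleCat

/-- An algebra isomorphic to the opposite endomorphism algebra of `G`, together with modules over
it isomorphic to the spaces of maps from `G`, all in the universe of the base field. -/
structure HomModules (k : Type w) [Field k] {C : Type u} [Category.{v} C] [Preadditive C]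
    [Linear k C] (G : C) where
  /-- the algebra -/
  R : Type w
  [ring : Ring R]
  [algebra : Algebra k R]
  /-- the isomorphism with the opposite endomorphism algebra -/
  toEnd : R ≃ₗ[k] (G ⟶ G)
  toEnd_one : toEnd 1 = 𝟙 G
  toEnd_mul : ∀ r s, toEnd (r * s) = toEnd r ≫ toEnd s
  /-- the module attached to an object -/
  M : C → ModuleCat.{w} R
  /-- the isomorphism with the space of maps from `G` -/
  toHom : ∀ X, M X ≃+ (G ⟶ X)
  toHom_smul : ∀ X r m, toHom X (r • m) = toEnd r ≫ toHom X m

attribute [instance] HomModules.ring HomModules.algebra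

theorem nonempty_homModules (k : Type w) [Field k] {C : Type u} [Category.{v} C] [Preadditive C]
    [Linear k C] (hfin : ∀ X Y : C, FiniteDimensional k (X ⟶ Y)) (G : C) :
    Nonempty (HomModules k G) := by
  -- Finite dimension over `k` makes the `Hom`-spaces small in the universe of `k`, where the
  -- modules must live.
  have hs : ∀ X : C, Small.{w} (G ⟶ X) := fun X =>
    have := hfin G X
    Module.Finite.small.{w} k (G ⟶ X)
  have : FiniteDimensional k (End G) := hfin G G
  have : Small.{w} (End G)ᵐᵒᵖ := 
    have : Small.{w} (End G) := hs G
    small_map (MulOpposite.opEquiv (α := End G)).symm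
  let R := Shrink.{w} (End G)ᵐᵒᵖ
  let ρ : R ≃ₐ[k] (End G)ᵐᵒᵖ := Shrink.algEquiv k (End G)ᵐᵒᵖ
  let inst : ∀ X : C, Module R (G ⟶ X) := fun X =>
    { smul := fun r f => (show G ⟶ G from (ρ r).unop) ≫ f
      one_smul := fun f => by
        change (show G ⟶ G from (ρ 1).unop) ≫ f = f
        rw [map_one]
        exact Category.id_comp f
      mul_smul := fun r s f => by
        change (show G ⟶ G from (ρ (r * s)).unop) ≫ f = _
        rw [map_mul]
        exact Category.assoc _ _ _
      smul_zero := fun r => comp_zero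
      smul_add := fun r f g => Preadditive.comp_add _ _ _ _ _ _
      add_smul := fun r s f => by
        change (show G ⟶ G from (ρ (r + s)).unop) ≫ f = _
        rw [map_add]
        exact Preadditive.add_comp _ _ _ _ _ _
      zero_smul := fun f => by
        change (show G ⟶ G from (ρ 0).unop) ≫ f = 0
        rw [map_zero]
        exact zero_comp }
  exact ⟨{
    R := R
    toEnd := ρ.toLinearEquiv.trans (MulOpposite.opLinearEquiv k (M := End G)).symm
    toEnd_one := congrArg MulOpposite.unop (map_one ρ)
    toEnd_mul := fun r s => congrArg MulOpposite.unop (map_mul ρ r s)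
    M := fun X => ModuleCat.of R (Shrink.{w} (G ⟶ X))
    toHom := fun X => (Shrink.linearEquiv R (G ⟶ X)).toAddEquiv
    toHom_smul := fun X r m => (Shrink.linearEquiv R (G ⟶ X)).map_smul r m }⟩

namespace HomModules

variable {k : Type w} [Field k] {C : Type u} [Category.{v} C] [Abelian C] [Linear k C] {G : C}
  (H : HomModules k G)

/-- The isomorphism from the module attached to `X` to the space of maps to `X`, as a linear map. -/
def toHomₗ (X : C) : H.M X ≃ₗ[k] (G ⟶ X) :=
  { H.toHom X with
    map_smul' := fun c m => by
      change H.toHom X (algebraMap k H.R c • m) = c • H.toHom X m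
      rw [H.toHom_smul, Algebra.algebraMap_eq_smul_one, map_smul, H.toEnd_one, Linear.smul_comp,
        Category.id_comp] }

theorem toHomₗ_smul (X : C) (r : H.R) (m : H.M X) :
    H.toHomₗ X (r • m) = H.toEnd r ≫ H.toHomₗ X m :=
  H.toHom_smul X r m

theorem toHomₗ_symm_comp (X : C) (e : G ⟶ G) (f : G ⟶ X) :
    (H.toHomₗ X).symm (e ≫ f) = H.toEnd.symm e • (H.toHomₗ X).symm f := by
  rw [LinearEquiv.symm_apply_eq, toHomₗ_smul, LinearEquiv.apply_symm_apply,
    LinearEquiv.apply_symm_apply]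

theorem toEnd_symm_comp (e f : G ⟶ G) :
    H.toEnd.symm (e ≫ f) = H.toEnd.symm e * H.toEnd.symm f := by
  rw [LinearEquiv.symm_apply_eq, H.toEnd_mul, LinearEquiv.apply_symm_apply,
    LinearEquiv.apply_symm_apply]

/-- The functor represented by `G`, with values in modules. -/
def functor : C ⥤ ModuleCat.{w} H.R where
  obj := H.M
  map {X Y} f := ModuleCat.ofHom
    { toFun := fun m => (H.toHomₗ Y).symm (H.toHomₗ X m ≫ f)
      map_add' := fun m m' => by simp
      map_smul' := fun r m => by
        rw [toHomₗ_smul, Category.assoc, toHomₗ_symm_comp, LinearEquiv.symm_apply_apply,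
          RingHom.id_apply] }
  map_id X := by
    ext m
    change (H.toHomₗ X).symm (H.toHomₗ X m ≫ 𝟙 X) = m
    rw [Category.comp_id, LinearEquiv.symm_apply_apply]
  map_comp {X Y T} f g := by
    ext m
    change (H.toHomₗ T).symm (H.toHomₗ X m ≫ f ≫ g) =
      (H.toHomₗ T).symm (H.toHomₗ Y ((H.toHomₗ Y).symm (H.toHomₗ X m ≫ f)) ≫ g)
    rw [LinearEquiv.apply_symm_apply, Category.assoc]

theorem functor_map_apply {X Y : C} (f : X ⟶ Y) (m : H.M X) :
    H.functor.map f m = (H.toHomₗ Y).symm (H.toHomₗ X m ≫ f) :=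
  rfl

theorem functor_linear : H.functor.Linear k where
  map_smul {X Y} f c := by
    ext m
    change (H.toHomₗ Y).symm (H.toHomₗ X m ≫ (c • f)) = c • (H.toHomₗ Y).symm (H.toHomₗ X m ≫ f)
    rw [Linear.comp_smul, map_smul]

theorem functor_faithful [Projective G] (hG : ∀ X : C, (∀ f : G ⟶ X, f = 0) → IsZero X) :
    H.functor.Faithful where
  map_injective {X Y} f g h := by
    rw [← sub_eq_zero]
    refine eq_zero_of_progenerator hG _ fun e => ?_
    rw [Preadditive.comp_sub, sub_eq_zero]
    have := congrArg (fun φ : H.functor.obj X ⟶ H.functor.obj Y => φ ((H.toHomₗ X).symm e)) h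
    dsimp only at this
    rw [functor_map_apply, functor_map_apply, LinearEquiv.apply_symm_apply] at this
    exact (H.toHomₗ Y).symm.injective this

theorem functor_full (hfin : ∀ X Y : C, FiniteDimensional k (X ⟶ Y)) [Projective G]
    (hG : ∀ X : C, (∀ f : G ⟶ X, f = 0) → IsZero X) : H.functor.Full where
  map_surjective {X Y} φ := by
    have := hfin G X
    obtain ⟨n, p, _⟩ := exists_epi_biproduct_of_progenerator (k := k) hG X
    let φ' : H.M X →ₗ[H.R] H.M Y := φ.hom
    let ψ : (G ⟶ X) →+ (G ⟶ Y) := (H.toHomₗ Y).toLinearMap.toAddMonoidHom.comp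
      (φ'.toAddMonoidHom.comp (H.toHomₗ X).symm.toLinearMap.toAddMonoidHom)
    have hψ' : ∀ h, ψ h = H.toHomₗ Y (φ' ((H.toHomₗ X).symm h)) := fun _ => rfl
    obtain ⟨f, hf⟩ := exists_eq_comp_of_equivariant hG p ψ fun e h => by
      rw [hψ', toHomₗ_symm_comp, map_smul, toHomₗ_smul, LinearEquiv.apply_symm_apply, hψ']
    refine ⟨f, ?_⟩
    ext m
    change (H.toHomₗ Y).symm (H.toHomₗ X m ≫ f) = φ' m
    rw [← hf, hψ', LinearEquiv.symm_apply_apply]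
    exact congrArg φ' ((H.toHomₗ X).symm_apply_apply m)

attribute [local instance] Abelian.hasFiniteBiproducts

/-- A presentation of `N` is realised in `C`: generators give `θ : Hom(G, Gⁿ) ⟶ N`, a spanning set
of its kernel assembles to `g : Gʳ ⟶ Gⁿ`, and `Hom(G, coker g) ≅ N` because `G` is projective. -/
theorem exists_iso (hfin : ∀ X Y : C, FiniteDimensional k (X ⟶ Y)) [Projective G]
    (N : ModuleCat.{w} H.R) [FiniteDimensional k N] : ∃ X : C, Nonempty (H.functor.obj X ≅ N) := by
  have : Module.Finite H.R N := Module.Finite.of_restrictScalars_finite k H.R N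
  obtain ⟨n, s, hs⟩ := Submodule.fg_iff_exists_fin_generating_family.mp
    (Module.Finite.fg_top (R := H.R) (M := N))
  let θ : (G ⟶ ⨁ fun _ : Fin n => G) →+ N :=
    { toFun := fun y => ∑ b, H.toEnd.symm (y ≫ biproduct.π _ b) • s b
      map_zero' := by simp
      map_add' := fun y z => by
        simp only [Preadditive.add_comp, map_add, add_smul, Finset.sum_add_distrib] }
  have hθ : ∀ y, θ y = ∑ b, H.toEnd.symm (y ≫ biproduct.π _ b) • s b := fun _ => rfl
  have hθc : ∀ e y, θ (e ≫ y) = H.toEnd.symm e • θ y := fun e y => by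
    simp only [hθ, Finset.smul_sum, Category.assoc, toEnd_symm_comp, mul_smul]
  have hsurj : Function.Surjective θ := fun x => by
    have hx : x ∈ Submodule.span H.R (Set.range s) := hs ▸ Submodule.mem_top
    obtain ⟨c, rfl⟩ := (Submodule.mem_span_range_iff_exists_fun H.R).mp hx
    refine ⟨biproduct.lift fun b => H.toEnd (c b), ?_⟩
    simp [hθ]
  let K : Submodule k (G ⟶ ⨁ fun _ : Fin n => G) :=
    { carrier := {y | θ y = 0}
      add_mem' := fun {a b} ha hb => by
        change θ (a + b) = 0
        rw [map_add, show θ a = 0 from ha, show θ b = 0 from hb, add_zero]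
      zero_mem' := map_zero θ
      smul_mem' := fun c y hy => by
        change θ (c • y) = 0
        rw [← Category.id_comp y, ← Linear.smul_comp, hθc, show θ y = 0 from hy, smul_zero] }
  have := hfin G (⨁ fun _ : Fin n => G)
  obtain ⟨r, t, ht⟩ := Submodule.fg_iff_exists_fin_generating_family.mp
    ((IsNoetherian.noetherian K : K.FG))
  let g := biproduct.desc t
  let π := cokernel.π g
  have h₁ : ∀ y, θ y = 0 → y ≫ π = 0 := fun y hy => by
    have hle : Submodule.span k (Set.range t) ≤ LinearMap.ker (Linear.rightComp k G π) := by
      rw [Submodule.span_le]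
      rintro _ ⟨a, rfl⟩
      have := biproduct.ι _ a ≫= cokernel.condition g
      rwa [biproduct.ι_desc_assoc, comp_zero] at this
    exact hle (ht ▸ (show y ∈ K from hy))
  have h₂ : ∀ y, y ≫ π = 0 → θ y = 0 := fun y hy => by
    obtain ⟨z, rfl⟩ : ∃ z, z ≫ g = y :=
      ⟨(ShortComplex.cokernelSequence_exact g).liftFromProjective y hy,
        (ShortComplex.cokernelSequence_exact g).liftFromProjective_comp y hy⟩
    rw [comp_biproduct_desc, map_sum]
    refine Finset.sum_eq_zero fun b _ => ?_
    have : t b ∈ K := ht ▸ Submodule.subset_span ⟨b, rfl⟩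
    rw [hθc, show θ (t b) = 0 from this, smul_zero]
  -- The chosen lifts need not be additive; `h₃` shows that `θ` of a lift depends only on the map
  -- lifted.
  let l : (G ⟶ cokernel g) → (G ⟶ ⨁ fun _ : Fin n => G) := fun x => Projective.factorThru x π
  have hl : ∀ x, l x ≫ π = x := fun x => Projective.factorThru_comp x π
  have h₃ : ∀ y z, y ≫ π = z ≫ π → θ y = θ z := fun y z h => by
    rw [← sub_eq_zero, ← map_sub]
    exact h₂ _ (by rw [Preadditive.sub_comp, h, sub_self])
  let Ψ : H.M (cokernel g) →ₗ[H.R] N :=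
    { toFun := fun m => θ (l (H.toHomₗ _ m))
      map_add' := fun m m' => by
        rw [← map_add]
        exact h₃ _ _ (by rw [Preadditive.add_comp, hl, hl, hl, map_add])
      map_smul' := fun a m => by
        rw [toHomₗ_smul, RingHom.id_apply, ← H.toEnd.symm_apply_apply a, ← hθc]
        exact h₃ _ _ (by rw [Category.assoc, hl, hl, LinearEquiv.apply_symm_apply]) }
  have hΨ : ∀ m, Ψ m = θ (l (H.toHomₗ _ m)) := fun _ => rfl
  refine ⟨cokernel g, ⟨(LinearEquiv.ofBijective Ψ ⟨?_, fun x => ?_⟩).toModuleIso⟩⟩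
  · rw [injective_iff_map_eq_zero]
    intro m hm
    have := h₁ _ hm
    rw [hl] at this
    exact (LinearEquiv.map_eq_zero_iff _).mp this
  · obtain ⟨y, rfl⟩ := hsurj x
    refine ⟨(H.toHomₗ _).symm (y ≫ π), ?_⟩
    rw [hΨ, LinearEquiv.apply_symm_apply]
    exact h₃ _ _ (hl _)

end HomModules

theorem IsFiniteOver.isModuleCategoryOver {k : Type w} [Field k] {C : Type u} [Category.{v} C]
    [Abelian C] [Linear k C] (h : IsFiniteOver k C) : IsModuleCategoryOver k C := by
  obtain ⟨hfin, G, _, hG⟩ := h.hasProgenerator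
  obtain ⟨H⟩ := nonempty_homModules k hfin G
  have hM : ∀ X, FiniteDimensional k (H.functor.obj X) := fun X =>
    have := hfin G X
    Module.Finite.equiv (H.toHomₗ X).symm
  have := hfin G G
  have := H.functor_faithful hG
  have := H.functor_full hfin hG
  have := H.functor_linear
  let F : C ⥤ FDModuleCat k H.R := ObjectProperty.lift _ H.functor hM
  have : F.EssSurj := ⟨fun N => by
    have := N.property
    obtain ⟨X, ⟨e⟩⟩ := H.exists_iso hfin N.obj
    exact ⟨X, ⟨ObjectProperty.isoMk _ e⟩⟩⟩
  have : F.IsEquivalence := { }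
  refine ⟨H.R, inferInstance, inferInstance, Module.Finite.equiv H.toEnd.symm,
    F.asEquivalence, ⟨fun {X Y} f c => ?_⟩⟩
  ext1
  exact H.functor.map_smul c f

theorem isModuleCategoryOver_iff_isFiniteOver {k : Type w} [Field k] {C : Type u} [Category.{v} C]
    [Abelian C] [Linear k C] : IsModuleCategoryOver k C ↔ IsFiniteOver k C :=
  ⟨fun h => h.isFiniteOver, fun h => h.isModuleCategoryOver⟩

end Morita

/-! ### Induction along the stratification -/

namespace Stratification

variable {k : Type w} [Field k] {A : Type u} [Category.{v} A] [Abelian A] [Linear k A]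
  {Λ : Type u₁} [PartialOrder Λ] (𝒮 : Stratification.{w, v, v₂, v₃, u, u₁, u₂, u₃} k A Λ)

theorem isFiniteOver_erase_iff {S : LowerSet Λ} {l : Λ} (hl : Maximal (· ∈ S) l) :
    IsFiniteOver k (𝒮.cat S) ↔
      IsFiniteOver k (𝒮.cat (S.erase l)) ∧ IsFiniteOver k (𝒮.stratum l) := by
  have := 𝒮.incl_linear (S := S.erase l) (T := S) LowerSet.erase_le
  have := 𝒮.quot_linear hl
  have R := 𝒮.recollement hl
  exact ⟨fun h => ⟨R.isFiniteOver_left h, R.isFiniteOver_right h⟩,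
    fun h => R.isFiniteOver h.1 h.2⟩

theorem isFiniteOver_bot : IsFiniteOver k (𝒮.cat ⊥) where
  length X := .zero X (𝒮.isZero_bot X)
  enough_projectives X := ⟨X, 𝟙 X, (𝒮.isZero_bot X).projective, inferInstance,
    fun T α h => by simpa using h⟩
  finite_simples := ⟨0, Fin.elim0, fun a => a.elim0,
    fun X hX => (Simple.not_isZero X (𝒮.isZero_bot X)).elim⟩
  finite_hom X Y := by
    have : Subsingleton (X ⟶ Y) := ⟨fun _ _ => (𝒮.isZero_bot X).eq_of_src _ _⟩
    infer_instance

theorem isFiniteOver_cat_iff [Finite Λ] (S : LowerSet Λ) :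
    IsFiniteOver k (𝒮.cat S) ↔ ∀ l ∈ S, IsFiniteOver k (𝒮.stratum l) := by
  induction S using WellFoundedLT.induction with
  | _ S ih =>
    by_cases hS : S = ⊥
    · subst hS
      exact ⟨fun _ l hl => (LowerSet.notMem_bot hl).elim, fun _ => 𝒮.isFiniteOver_bot⟩
    · have hne : (S : Set Λ).Nonempty := by
        rwa [Set.nonempty_iff_ne_empty, ne_eq, LowerSet.coe_eq_empty]
      obtain ⟨l, hl⟩ := (Set.toFinite (S : Set Λ)).exists_maximal hne
      have hl : Maximal (· ∈ S) l := hl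
      rw [𝒮.isFiniteOver_erase_iff hl, ih _ (LowerSet.erase_lt.mpr hl.1)]
      -- `erase` discards everything above `l`; by maximality that is only `l` itself.
      have hmem : ∀ x, x ∈ S.erase l ↔ x ∈ S ∧ ¬ l ≤ x := fun x => Iff.rfl
      refine ⟨fun h x hx => ?_, fun h => ⟨fun x hx => h x ((hmem x).mp hx).1, h l hl.1⟩⟩
      by_cases hlx : l ≤ x
      · rw [le_antisymm (hl.2 hx hlx) hlx]
        exact h.2
      · exact h.1 x ((hmem x).mpr ⟨hx, hlx⟩)

theorem isFiniteOver_iff [Finite Λ] :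
    IsFiniteOver k A ↔ ∀ l, IsFiniteOver k (𝒮.stratum l) := by
  have := 𝒮.total_linear
  rw [← IsFiniteOver.iff_of_equivalence 𝒮.total, isFiniteOver_cat_iff]
  simp

end Stratification

end AbelianStratification

theorem corollary4p8 (k : Type w) [Field k] (A : Type u) [Category.{v} A] [Abelian A]
    [Linear k A] (Λ : Type u₁) [PartialOrder Λ] [Finite Λ]
    (𝒮 : AbelianStratification.Stratification.{w, v, v₂, v₃, u, u₁, u₂, u₃} k A Λ) :
    (AbelianStratification.IsFiniteOver k A ↔
      ∀ l : Λ, AbelianStratification.IsFiniteOver k (𝒮.stratum l)) ∧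
    (AbelianStratification.IsModuleCategoryOver k A ↔
      ∀ l : Λ, AbelianStratification.IsModuleCategoryOver k (𝒮.stratum l)) := by
  simp only [AbelianStratification.isModuleCategoryOver_iff_isFiniteOver, and_self]
  exact 𝒮.isFiniteOver_iff
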